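/- Throughout, $\mathbb{N}=\{0,1,2,\dots\}$, and $S\subseteq\mathbb{N}$ is regarded as a subset of $\mathbb{R}=\mathbb{R}^1$. **Definitions.** A set $T\subseteq\mathbb{R}^n$ is *rational-MILP representable* if there are $p,d\in\mathbb{N}$ and a rational polyhedron $M\subseteq\mathbb{R}^{n+p+d}$ (the solution set of finitely many linear inequalities with rational coefficients and right-hand sides) with $$T=\{x\in\mathbb{R}^n:\exists\,y\in\mathbb{R}^p,\ z\in\mathbb{Z}^d,\ (x,y,z)\in M\}.$$ Let $C\subseteq\mathbb{R}^d$ be convex and let $(B_z)_{z\in C}$ be a family of convex subsets of $\mathbb{R}^{n+p}$. The family is *convex* if $\lambda B_z+(1-\lambda)B_{z'}\subseteq B_{\lambda z+(1-\lambda)z'}$ for all $z,z'\in C$, $\lambda\in[0,1]$. It is *closed* if each $B_z$ is closed and, whenever $z_m\in C$, $w_m\in B_{z_m}$, $z_m\to z$ and $w_m\to w$, then $z\in C$ and $w\in B_z$. An unbounded convex set $C\subseteq\mathbb{R}^d$ is *rationally unbounded* if for every rational matrix $L\in\mathbb{Q}^{d\times d}$ the image $C'=L(C)$ is either bounded or admits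 $r\in\mathbb{Z}^d\setminus\{0\}$ such that $x+\lambda r\in C'$ for all $x\in\mathbb{Z}^d\cap C'$ and all real $\lambda\ge 0$. An infinite set $A\subseteq\mathbb{Z}^d$ is *rationally unbounded* if there is a finite $I\subseteq A$ such that the convex hull $\operatorname{conv}(A\setminus I)$ is rationally unbounded. A set $S\subseteq\mathbb{R}^n$ is *rational-MICP representable* if there are $p,d\in\mathbb{N}$, a convex set $C\subseteq\mathbb{R}^d$ and a closed convex family $(B_z)_{z\in C}$ of nonempty subsets of $\mathbb{R}^{n+p}$ such that $$S=\bigcup_{z\in C\cap\mathbb{Z}^d}\operatorname{proj}_x(B_z)$$ (where $\operatorname{proj}_x$ is the projection onto the first $n$ coordinates) and $C\cap\mathbb{Z}^d$ is either bounded or rationally unbounded. An *infinite arithmetic progression* is a set $\{am+b:m\in\mathbb{N}\}$ with $a,b\in\mathbb{N}$, $a\ge 1$. **Theorem.** Let $S\subseteq\mathbb{N}$. The following are equivalent. (a) $S$ is rational-MICP representable. (b) There are $k\in\mathbb{N}$, a finite set $A_0\subseteq\mathbb{N}$ and infinite arithmetic progressions $A_1,\dots,A_k\subseteq\mathbb{N}$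 such that $S=A_0\cup\bigcup_{i=1}^k A_i$. (c) There are a finite set $A_0$ and a rational-MILP representable set $T\subseteq\mathbb{R}$ such that $S=A_0\cup T$. -/

import Mathlib

namespace MICP

open Filter Topology
open scoped Pointwise

/-- The lattice `ℤ^d`, as a subset of `ℝ^d`. -/
def integerPoints (d : ℕ) : Set (Fin d → ℝ) :=
  Set.range fun (w : Fin d → ℤ) (i : Fin d) => (w i : ℝ)

/-- A set of natural numbers, as a subset of `ℝ^1`. -/
def ofNatSet (S : Set ℕ) : Set (Fin 1 → ℝ) :=
  (fun (n : ℕ) (_ : Fin 1) => (n : ℝ)) '' S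

/-! ### Mixed-integer formulations and rational-MILP representability -/

/-- `M ⊆ ℝ^(n+p+d)` induces a mixed-integer formulation of `S ⊆ ℝ^n`:
`S = proj_x (M ∩ (ℝ^(n+p) × ℤ^d))`. -/
def Induces {n p d : ℕ} (M : Set ((Fin n → ℝ) × (Fin p → ℝ) × (Fin d → ℝ)))
    (S : Set (Fin n → ℝ)) : Prop :=
  S = {x | ∃ (y : Fin p → ℝ) (z : Fin d → ℝ), z ∈ integerPoints d ∧ (x, y, z) ∈ M}

/-- `M ⊆ ℝ^(n+p+d)` is a rational polyhedron: the solution set of a finite system of linear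
inequalities `A x + B y + D z ≤ b` with rational coefficients and right-hand sides. -/
def IsRationalPolyhedron {n p d : ℕ}
    (M : Set ((Fin n → ℝ) × (Fin p → ℝ) × (Fin d → ℝ))) : Prop :=
  ∃ (m : ℕ) (A : Matrix (Fin m) (Fin n) ℚ) (B : Matrix (Fin m) (Fin p) ℚ)
    (D : Matrix (Fin m) (Fin d) ℚ) (b : Fin m → ℚ),
    M = {w | ∀ i : Fin m,
      ∑ j, (A i j : ℝ) * w.1 j + ∑ j, (B i j : ℝ) * w.2.1 j + ∑ j, (D i j : ℝ) * w.2.2 j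
        ≤ (b i : ℝ)}

/-- `S ⊆ ℝ^n` is rational-MILP representable. -/
def IsRationalMILPRepresentable {n : ℕ} (S : Set (Fin n → ℝ)) : Prop :=
  ∃ (p d : ℕ) (M : Set ((Fin n → ℝ) × (Fin p → ℝ) × (Fin d → ℝ))),
    IsRationalPolyhedron M ∧ Induces M S

/-! ### Closed convex families -/

/-- `(A_z)_{z ∈ C}` is a convex family of (convex) subsets of `E`, indexed by the convex set `C`.
The values of `A` outside `C` are irrelevant. -/
structure IsConvexFamily {d : ℕ} {E : Type*} [AddCommGroup E] [Module ℝ E]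
    (C : Set (Fin d → ℝ)) (A : (Fin d → ℝ) → Set E) : Prop where
  convex_index : Convex ℝ C
  convex_fiber : ∀ z ∈ C, Convex ℝ (A z)
  combo_subset : ∀ z ∈ C, ∀ z' ∈ C, ∀ t : ℝ, 0 ≤ t → t ≤ 1 →
    t • A z + (1 - t) • A z' ⊆ A (t • z + (1 - t) • z')

/-- The family `(A_z)_{z ∈ C}` is closed: every `A_z` is closed, and for all convergent sequences
`z_m ∈ C`, `x_m ∈ A_{z_m}` one has `lim x_m ∈ A_{lim z_m}`; as `A_z` is only available for
`z ∈ C`, this includes `lim z_m ∈ C`. -/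
structure IsClosedFamily {d : ℕ} {E : Type*} [TopologicalSpace E]
    (C : Set (Fin d → ℝ)) (A : (Fin d → ℝ) → Set E) : Prop where
  closed_fiber : ∀ z ∈ C, IsClosed (A z)
  lim_mem : ∀ (u : ℕ → Fin d → ℝ) (v : ℕ → E) (z : Fin d → ℝ) (x : E),
    (∀ m, u m ∈ C) → (∀ m, v m ∈ A (u m)) →
    Tendsto u atTop (𝓝 z) → Tendsto v atTop (𝓝 x) → z ∈ C ∧ x ∈ A z

/-- The closed convex family `(B_z)_{z ∈ C}` in `ℝ^(n+p)` represents `S ⊆ ℝ^n`: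
`S = ⋃_{z ∈ C ∩ ℤ^d} proj_x B_z`. -/
structure IsMICPRepresentation {n p d : ℕ} (S : Set (Fin n → ℝ)) (C : Set (Fin d → ℝ))
    (B : (Fin d → ℝ) → Set ((Fin n → ℝ) × (Fin p → ℝ))) : Prop where
  convexFamily : IsConvexFamily C B
  closedFamily : IsClosedFamily C B
  eq_iUnion : S = ⋃ z ∈ C ∩ integerPoints d, Prod.fst '' B z

/-! ### Rational unboundedness and rational-MICP representability -/

/-- An unbounded convex set `C ⊆ ℝ^d` is rationally unbounded if every image `C'` of `C` under a
rational linear map is bounded, or there is `r ∈ ℤ^d \ {0}` such that `x + t r ∈ C'` for all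
`x ∈ ℤ^d ∩ C'` and all real `t ≥ 0`. -/
structure IsRationallyUnboundedConvex {d : ℕ} (C : Set (Fin d → ℝ)) : Prop where
  convex : Convex ℝ C
  unbounded : ¬ Bornology.IsBounded C
  image : ∀ (L : Matrix (Fin d) (Fin d) ℚ) (C' : Set (Fin d → ℝ)),
    C' = (fun x => (L.map (fun q : ℚ => (q : ℝ))).mulVec x) '' C →
    Bornology.IsBounded C' ∨
      ∃ r ∈ integerPoints d, r ≠ 0 ∧
        ∀ x ∈ integerPoints d ∩ C', ∀ t : ℝ, 0 ≤ t → x + t • r ∈ C'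

/-- An infinite set `A ⊆ ℤ^d` is rationally unbounded if `conv (A \ I)` is rationally unbounded for
some finite `I ⊆ A`. -/
structure IsRationallyUnboundedLattice {d : ℕ} (A : Set (Fin d → ℝ)) : Prop where
  subset : A ⊆ integerPoints d
  infinite : A.Infinite
  exists_finite : ∃ I : Set (Fin d → ℝ), I.Finite ∧ I ⊆ A ∧
    IsRationallyUnboundedConvex (convexHull ℝ (A \ I))

/-- `S ⊆ ℝ^n` is rational-MICP representable. -/
def IsRationalMICPRepresentable {n : ℕ} (S : Set (Fin n → ℝ)) : Prop :=
  ∃ (p d : ℕ) (C : Set (Fin d → ℝ)) (B : (Fin d → ℝ) → Set ((Fin n → ℝ) × (Fin p → ℝ))),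
    IsMICPRepresentation S C B ∧ (∀ z ∈ C, (B z).Nonempty) ∧
      (Bornology.IsBounded (C ∩ integerPoints d) ∨
        IsRationallyUnboundedLattice (C ∩ integerPoints d))

/-- An infinite arithmetic progression of natural numbers, `{a m + b : m ∈ ℕ}` with `a ≥ 1`. -/
def IsInfiniteAP (A : Set ℕ) : Prop :=
  ∃ a b : ℕ, 0 < a ∧ A = Set.range fun m : ℕ => a * m + b

end MICP

namespace MICP

open Filter Topology
open scoped Pointwise

/-! ### Farkas' lemma over `ℚ` -/

/-! All three conditions are equivalent to `IsPeriodicUpToFinite`: a finite set together with a set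
stable under some translation `P > 0`. Taking the least element in each residue class modulo `P`
turns this into (b).

For (c), `farkas` gives a dichotomy: either the homogeneous system has a rational solution `(1, v)`,
an integer multiple of which translates the represented set into itself, or some nonnegative
combination of the inequalities bounds `x`. Conversely, periodic sets are encoded by the lattice
points `(m, e_j)`, `e_j` selecting a base point and `m` counting periods.

For (a), the projection of each fibre over a lattice point is a nonempty convex set of naturals,
hence a single value `f z`, and convexity of the family makes `f` midpoint-affine on the lattice
points of `C`. Discarding finitely many of these, `f` lives on a convex set `K` whose rational
images are bounded or have an integer recession direction.
`IsMidpointAffineOn.isPeriodicUpToFinite_image` is an induction on `dim K`. Along an integer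
direction `r` of `K`, `f` is arithmetic, with a slope that is constant on each of finitely many
congruence classes. A nonzero slope is a period of the values on its class; if the slope is zero,
`f` factors through the projection along `r`, and the dimension drops.

For the converse, a rotated quadratic cone lets chosen rays be infinite while the other base points
stay isolated. -/

lemma exists_forall_mul_le {ι : Type*} [Fintype ι] (a h : ι → ℚ)
    (h0 : ∀ i, a i = 0 → 0 ≤ h i)
    (hpn : ∀ p n, 0 < a p → a n < 0 → 0 ≤ -a n * h p + a p * h n) :
    ∃ t : ℚ, ∀ i, a i * t ≤ h i := by
  classical
  by_cases hn : (Finset.univ.filter fun i => a i < 0).Nonempty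
  · obtain ⟨n, hnm, hmax⟩ := Finset.exists_max_image _ (fun i => h i / a i) hn
    simp only [Finset.mem_filter, Finset.mem_univ, true_and] at hnm hmax
    refine ⟨h n / a n, fun i => ?_⟩
    rcases lt_trichotomy (a i) 0 with hi | hi | hi
    · have h1 := mul_le_mul_of_nonpos_left (hmax i hi) hi.le
      rwa [mul_div_cancel₀ _ hi.ne] at h1
    · simpa [hi] using h0 i hi
    · have h1 := hpn i n hi hnm
      rw [← mul_div_assoc, div_le_iff_of_neg hnm]
      linarith
  · by_cases hp : (Finset.univ.filter fun i => 0 < a i).Nonempty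
    · obtain ⟨p, hpm, hmin⟩ := Finset.exists_min_image _ (fun i => h i / a i) hp
      simp only [Finset.mem_filter, Finset.mem_univ, true_and] at hpm hmin
      refine ⟨h p / a p, fun i => ?_⟩
      rcases lt_trichotomy (a i) 0 with hi | hi | hi
      · exact absurd ⟨i, by simpa using hi⟩ hn
      · simpa [hi] using h0 i hi
      · have h1 := mul_le_mul_of_nonneg_left (hmin i hi) hi.le
        rwa [mul_div_cancel₀ _ hi.ne'] at h1
    · refine ⟨0, fun i => ?_⟩
      rcases lt_trichotomy (a i) 0 with hi | hi | hi
      · exact absurd ⟨i, by simpa using hi⟩ hn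
      · simpa [hi] using h0 i hi
      · exact absurd ⟨i, by simpa using hi⟩ hp

/-- **Farkas' lemma** for a finite system `G v ≤ g` over `ℚ`. -/
theorem farkas (N : ℕ) : ∀ {ι : Type} [Fintype ι] (G : ι → Fin N → ℚ) (g : ι → ℚ),
    (∃ v : Fin N → ℚ, ∀ i, ∑ j, G i j * v j ≤ g i) ∨
      ∃ u : ι → ℚ, (∀ i, 0 ≤ u i) ∧ (∀ j, ∑ i, u i * G i j = 0) ∧ ∑ i, u i * g i < 0 := by
  classical
  induction N with
  | zero =>
    intro ι _ G g
    by_cases hg : ∀ i, 0 ≤ g i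
    · exact Or.inl ⟨0, fun i => by simpa using hg i⟩
    · push Not at hg
      obtain ⟨i, hi⟩ := hg
      refine Or.inr ⟨Pi.single i 1, fun k => ?_, fun j => j.elim0, ?_⟩
      · by_cases h : k = i
        · subst h; simp
        · simp [h]
      · simpa [Pi.single_apply] using hi
  | succ N ih =>
    intro ι _ G g
    set a : ι → ℚ := fun i => G i 0 with ha
    -- Fourier–Motzkin elimination of variable 0: rows with zero coefficient are kept, and rows of
    -- opposite signs are combined so that it cancels. All other pairs contribute the trivial row `0
    -- ≤ 0`.
    let W : ι × ι → ι → ℚ := fun k i =>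
      if a k.1 = 0 then (if i = k.1 then 1 else 0)
      else if 0 < a k.1 ∧ a k.2 < 0 then
        (if i = k.1 then -a k.2 else 0) + (if i = k.2 then a k.1 else 0)
      else 0
    have hW : ∀ k i, 0 ≤ W k i := by
      intro k i
      simp only [W]
      split_ifs with h1 h2 h3 h4 h5 <;> first | positivity | linarith [h3.1, h3.2]
    have hWsum : ∀ (k : ι × ι) (x : ι → ℚ), ∑ i, W k i * x i =
        if a k.1 = 0 then x k.1 else if 0 < a k.1 ∧ a k.2 < 0 then
          -a k.2 * x k.1 + a k.1 * x k.2 else 0 := by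
      intro k x
      simp only [W]
      split_ifs
      · simp
      · simp [add_mul, Finset.sum_add_distrib]
      · simp
    have hWa : ∀ k, ∑ i, W k i * a i = 0 := by
      intro k
      rw [hWsum]
      split_ifs with h1 h2
      · exact h1
      · ring
      · rfl
    rcases ih (fun k j => ∑ i, W k i * G i j.succ) (fun k => ∑ i, W k i * g i) with
      ⟨v, hv⟩ | ⟨u, hu, hu0, hug⟩
    · left
      have hv' : ∀ k, 0 ≤ ∑ i, W k i * (g i - ∑ j, G i j.succ * v j) := by
        intro k
        have h1 := hv k
        simp only [mul_sub, Finset.sum_sub_distrib, Finset.mul_sum, Finset.sum_mul] at h1 ⊢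
        rw [Finset.sum_comm] at h1
        simp only [← mul_assoc]
        linarith
      obtain ⟨t, ht⟩ := exists_forall_mul_le a (fun i => g i - ∑ j, G i j.succ * v j)
        (fun i hi => by
          have := hv' (i, i)
          rwa [hWsum, if_pos hi] at this)
        (fun p n hp hn => by
          have := hv' (p, n)
          rwa [hWsum, if_neg hp.ne', if_pos ⟨hp, hn⟩] at this)
      refine ⟨Fin.cons t v, fun i => ?_⟩
      rw [Fin.sum_univ_succ]
      simp only [Fin.cons_zero, Fin.cons_succ]
      linarith [ht i]
    · right
      -- An infeasibility certificate of the eliminated system, composed with `W`, is one of the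
      -- original system.
      have key : ∀ x : ι → ℚ, ∑ i, (∑ k, u k * W k i) * x i = ∑ k, u k * ∑ i, W k i * x i := by
        intro x
        simp only [Finset.sum_mul, Finset.mul_sum, mul_assoc]
        exact Finset.sum_comm
      refine ⟨fun i => ∑ k, u k * W k i,
        fun i => Finset.sum_nonneg fun k _ => mul_nonneg (hu k) (hW k i), fun j => ?_, ?_⟩
      · rw [key]
        refine Fin.cases ?_ (fun j => ?_) j
        · simp [show ∀ k, ∑ i, W k i * G i 0 = 0 from hWa]
        · exact hu0 j
      · rw [key]; exact hug

/-! ### Eventually periodic sets of natural numbers -/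

/-- A set of natural numbers that is the union of a finite set and a set stable under a positive
translation. -/
def IsPeriodicUpToFinite (S : Set ℕ) : Prop :=
  ∃ P : ℕ, 0 < P ∧ ∃ F T : Set ℕ, F.Finite ∧ (∀ t ∈ T, t + P ∈ T) ∧ S = F ∪ T

lemma add_mul_mem {T : Set ℕ} {P : ℕ} (hT : ∀ t ∈ T, t + P ∈ T) {t : ℕ} (ht : t ∈ T) (k : ℕ) :
    t + k * P ∈ T := by
  induction k with
  | zero => simpa using ht
  | succ k ih => simpa [add_mul, add_assoc] using hT _ ih

lemma IsPeriodicUpToFinite.of_finite {S : Set ℕ} (hS : S.Finite) : IsPeriodicUpToFinite S :=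
  ⟨1, one_pos, S, ∅, hS, by simp, by simp⟩

lemma IsPeriodicUpToFinite.of_add_mem {S : Set ℕ} {P : ℕ} (hP : 0 < P)
    (hS : ∀ t ∈ S, t + P ∈ S) : IsPeriodicUpToFinite S :=
  ⟨P, hP, ∅, S, Set.finite_empty, hS, by simp⟩

lemma IsPeriodicUpToFinite.union {S S' : Set ℕ} (hS : IsPeriodicUpToFinite S)
    (hS' : IsPeriodicUpToFinite S') : IsPeriodicUpToFinite (S ∪ S') := by
  obtain ⟨P, hP, F, T, hF, hT, rfl⟩ := hS
  obtain ⟨P', hP', F', T', hF', hT', rfl⟩ := hS'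
  refine ⟨P' * P, Nat.mul_pos hP' hP, F ∪ F', T ∪ T', hF.union hF', ?_,
    Set.union_union_union_comm ..⟩
  rintro t (ht | ht)
  · exact Or.inl (add_mul_mem hT ht P')
  · rw [mul_comm]; exact Or.inr (add_mul_mem hT' ht P)

lemma IsPeriodicUpToFinite.biUnion {ι : Type*} {s : Set ι} (hs : s.Finite) {S : ι → Set ℕ}
    (hS : ∀ i ∈ s, IsPeriodicUpToFinite (S i)) : IsPeriodicUpToFinite (⋃ i ∈ s, S i) := by
  induction s, hs using Set.Finite.induction_on with
  | empty => simpa using IsPeriodicUpToFinite.of_finite Set.finite_empty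
  | insert _ _ ih =>
    rw [Set.biUnion_insert]
    exact (hS _ (Set.mem_insert _ _)).union (ih fun i hi => hS i (Set.mem_insert_of_mem _ hi))

lemma IsPeriodicUpToFinite.of_iUnion_isInfiniteAP {k : ℕ} {A₀ : Set ℕ} {A : Fin k → Set ℕ}
    (h₀ : A₀.Finite) (hA : ∀ i, IsInfiniteAP (A i)) : IsPeriodicUpToFinite (A₀ ∪ ⋃ i, A i) := by
  refine (IsPeriodicUpToFinite.of_finite h₀).union ?_
  have : (⋃ i, A i) = ⋃ i ∈ (Set.univ : Set (Fin k)), A i := by simp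
  rw [this]
  refine IsPeriodicUpToFinite.biUnion Set.finite_univ fun i _ => ?_
  obtain ⟨a, b, ha, h⟩ := hA i
  rw [h]
  refine IsPeriodicUpToFinite.of_add_mem ha ?_
  rintro _ ⟨m, rfl⟩
  exact ⟨m + 1, by ring⟩

/-- The base points: a set stable under translation by `P > 0` is `W + P ℕ` with `W` finite. -/
lemma exists_finite_base {T : Set ℕ} {P : ℕ} (hP : 0 < P) (hT : ∀ t ∈ T, t + P ∈ T) :
    ∃ W : Set ℕ, W.Finite ∧ T = {n | ∃ b ∈ W, ∃ m : ℕ, n = b + m * P} := by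
  refine ⟨{b | b ∈ T ∧ ∀ t ∈ T, t % P = b % P → b ≤ t}, ?_, ?_⟩
  · refine Set.Finite.of_finite_image (f := fun b => b % P)
      ((Set.finite_lt_nat P).subset ?_) ?_
    · rintro _ ⟨b, -, rfl⟩
      exact Nat.mod_lt _ hP
    · rintro b ⟨hb, hb'⟩ c ⟨hc, hc'⟩ h
      exact le_antisymm (hb' c hc h.symm) (hc' b hb h)
  · ext n
    constructor
    · intro hn
      classical
      have hex : ∃ t, t ∈ T ∧ t % P = n % P := ⟨n, hn, rfl⟩
      have hs := Nat.find_spec hex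
      have hle : Nat.find hex ≤ n := Nat.find_min' hex ⟨hn, rfl⟩
      refine ⟨Nat.find hex, ⟨hs.1, fun t ht h => Nat.find_min' hex ⟨ht, h.trans hs.2⟩⟩, ?_⟩
      obtain ⟨m, hm⟩ := (Nat.modEq_iff_dvd' hle).1 hs.2
      exact ⟨m, by rw [mul_comm]; omega⟩
    · rintro ⟨b, ⟨hb, -⟩, m, rfl⟩
      exact add_mul_mem hT hb m

lemma IsPeriodicUpToFinite.exists_isInfiniteAP {S : Set ℕ} (hS : IsPeriodicUpToFinite S) :
    ∃ (k : ℕ) (A₀ : Set ℕ) (A : Fin k → Set ℕ),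
      A₀.Finite ∧ (∀ i, IsInfiniteAP (A i)) ∧ S = A₀ ∪ ⋃ i, A i := by
  obtain ⟨P, hP, F, T, hF, hT, rfl⟩ := hS
  obtain ⟨W, hW, hTW⟩ := exists_finite_base hP hT
  have := hW.fintype
  refine ⟨Fintype.card W, F,
    fun i => Set.range fun m : ℕ => P * m + ((Fintype.equivFin W).symm i : ℕ), hF,
    fun i => ⟨P, _, hP, rfl⟩, ?_⟩
  congr 1
  rw [hTW]
  ext n
  simp only [Set.mem_ofPred_eq, Set.mem_iUnion, Set.mem_range]
  constructor
  · rintro ⟨b, hb, m, rfl⟩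
    exact ⟨Fintype.equivFin W ⟨b, hb⟩, m, by simp; ring⟩
  · rintro ⟨i, m, rfl⟩
    exact ⟨_, ((Fintype.equivFin W).symm i).2, m, by ring⟩

/-! ### Rational-MILP representable sets of natural numbers -/

/-- A common denominator of finitely many rational numbers. -/
lemma exists_common_denominator {ι : Type*} [Fintype ι] (q : ι → ℚ) :
    ∃ N : ℕ, 0 < N ∧ ∃ w : ι → ℤ, ∀ i, (N : ℚ) * q i = w i := by
  classical
  refine ⟨∏ i, (q i).den, Finset.prod_pos fun i _ => (q i).den_pos,
    fun i => (∏ k ∈ Finset.univ.erase i, ((q k).den : ℤ)) * (q i).num, fun i => ?_⟩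
  rw [← Finset.mul_prod_erase Finset.univ _ (Finset.mem_univ i)]
  push_cast
  have h := Rat.den_mul_eq_num (q i)
  rw [mul_comm ((q i).den : ℚ), mul_assoc, h]

lemma IsRationalMILPRepresentable.isPeriodicUpToFinite {T : Set (Fin 1 → ℝ)}
    (hT : IsRationalMILPRepresentable T) :
    IsPeriodicUpToFinite {n : ℕ | (fun _ => (n : ℝ)) ∈ T} := by
  obtain ⟨p, d, M, ⟨m, A, B, D, b, hM⟩, hMT⟩ := hT
  -- A solution `v` makes `(1, v)` a solution of the homogeneous system, and multiplying by a common
  -- denominator `N` keeps `z` integral under translation. A certificate `u` eliminates `y` and `z`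
  -- and leaves `c * x ≤ const` with `c > 0`.
  rcases farkas (p + d) (fun i => Fin.append (B i) (D i)) (fun i => -A i 0) with
    ⟨v, hv⟩ | ⟨u, hu, hu0, hug⟩
  · obtain ⟨N, hN, w, hw⟩ := exists_common_denominator v
    refine IsPeriodicUpToFinite.of_add_mem hN fun n hn => ?_
    rw [Set.mem_ofPred_eq] at hn ⊢
    rw [hMT] at hn ⊢
    obtain ⟨y, z, ⟨z', rfl⟩, hM'⟩ := hn
    refine ⟨fun j => y j + N * v (Fin.castAdd d j), fun j => z' j + N * v (Fin.natAdd p j),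
      ⟨fun j => z' j + w (Fin.natAdd p j), ?_⟩, ?_⟩
    · funext j
      have := congrArg (fun q : ℚ => (q : ℝ)) (hw (Fin.natAdd p j))
      push_cast at this ⊢
      rw [this]
    · rw [hM] at hM' ⊢
      intro i
      have h1 := hM' i
      have h2 : ((∑ j, Fin.append (B i) (D i) j * v j : ℚ) : ℝ) ≤ ((-A i 0 : ℚ) : ℝ) :=
        by exact_mod_cast hv i
      rw [Fin.sum_univ_add] at h2
      simp only [Fin.append_left, Fin.append_right] at h2
      push_cast at h2
      have h3 := mul_le_mul_of_nonneg_left h2 (Nat.cast_nonneg (α := ℝ) N)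
      simp only [Fin.sum_univ_one, mul_add, Finset.sum_add_distrib, Finset.mul_sum] at h1 h3 ⊢
      have e1 : ∀ j, (B i j : ℝ) * ((N : ℝ) * (v (Fin.castAdd d j) : ℝ)) =
        N * (B i j * v (Fin.castAdd d j)) := fun j => by ring
      have e2 : ∀ j, (D i j : ℝ) * ((N : ℝ) * (v (Fin.natAdd p j) : ℝ)) =
        N * (D i j * v (Fin.natAdd p j)) := fun j => by ring
      simp only [e1, e2]
      push_cast
      linarith
  · refine IsPeriodicUpToFinite.of_finite ?_
    set c : ℚ := ∑ i, u i * A i 0 with hc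
    have hcpos : 0 < c := by
      simp only [mul_neg, Finset.sum_neg_distrib] at hug
      linarith
    obtain ⟨k, hk⟩ := exists_nat_ge ((∑ i, u i * b i) / c)
    refine (Set.finite_le_nat k).subset fun n hn => ?_
    rw [Set.mem_ofPred_eq, hMT] at hn
    obtain ⟨y, z, -, hM'⟩ := hn
    rw [hM] at hM'
    have hsum : ∑ i, (u i : ℝ) * (∑ j, (A i j : ℝ) * (n : ℝ) + ∑ j, (B i j : ℝ) * y j +
        ∑ j, (D i j : ℝ) * z j) ≤ ∑ i, (u i : ℝ) * (b i : ℝ) :=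
      Finset.sum_le_sum fun i _ =>
        mul_le_mul_of_nonneg_left (hM' i) (by exact_mod_cast hu i)
    have hB : ∑ i, (u i : ℝ) * ∑ j, (B i j : ℝ) * y j = 0 := by
      simp only [Finset.mul_sum, ← mul_assoc]
      rw [Finset.sum_comm]
      refine Finset.sum_eq_zero fun j _ => ?_
      rw [← Finset.sum_mul]
      have := hu0 (Fin.castAdd d j)
      simp only [Fin.append_left] at this
      have h' : (∑ i, (u i : ℝ) * (B i j : ℝ)) = 0 := by exact_mod_cast this
      rw [h', zero_mul]
    have hD : ∑ i, (u i : ℝ) * ∑ j, (D i j : ℝ) * z j = 0 := by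
      simp only [Finset.mul_sum, ← mul_assoc]
      rw [Finset.sum_comm]
      refine Finset.sum_eq_zero fun j _ => ?_
      rw [← Finset.sum_mul]
      have := hu0 (Fin.natAdd p j)
      simp only [Fin.append_right] at this
      have h' : (∑ i, (u i : ℝ) * (D i j : ℝ)) = 0 := by exact_mod_cast this
      rw [h', zero_mul]
    simp only [mul_add, Finset.sum_add_distrib, hB, hD, add_zero, Fin.sum_univ_one,
      ← mul_assoc] at hsum
    rw [← Finset.sum_mul] at hsum
    have h4 : c * n ≤ ∑ i, u i * b i := by
      rw [hc]; exact_mod_cast hsum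
    have h5 : (n : ℚ) ≤ k := by
      refine le_trans ?_ hk
      rw [le_div_iff₀ hcpos]; linarith
    exact_mod_cast h5

lemma isPeriodicUpToFinite_of_milp {S : Set ℕ} {A₀ T : Set (Fin 1 → ℝ)} (h₀ : A₀.Finite)
    (hT : IsRationalMILPRepresentable T) (hS : ofNatSet S = A₀ ∪ T) : IsPeriodicUpToFinite S := by
  have hinj : Function.Injective fun (n : ℕ) (_ : Fin 1) => (n : ℝ) := fun a b h => by
    simpa using congrFun h 0
  have : S = {n : ℕ | (fun _ => (n : ℝ)) ∈ A₀} ∪ {n : ℕ | (fun _ => (n : ℝ)) ∈ T} := by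
    rw [← Set.preimage_image_eq S hinj]
    change _ ⁻¹' ofNatSet S = _
    rw [hS]
    rfl
  rw [this]
  exact (IsPeriodicUpToFinite.of_finite (h₀.preimage hinj.injOn)).union hT.isPeriodicUpToFinite

/-! ### Periodic sets are rational-MILP representable -/

lemma isRationalPolyhedron_of_fintype {n p d : ℕ} {ι : Type*} [Fintype ι]
    (A : ι → Fin n → ℚ) (B : ι → Fin p → ℚ) (D : ι → Fin d → ℚ) (b : ι → ℚ) :
    IsRationalPolyhedron {w : (Fin n → ℝ) × (Fin p → ℝ) × (Fin d → ℝ) | ∀ i,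
      ∑ j, (A i j : ℝ) * w.1 j + ∑ j, (B i j : ℝ) * w.2.1 j + ∑ j, (D i j : ℝ) * w.2.2 j
        ≤ (b i : ℝ)} := by
  let e := (Fintype.equivFin ι).symm
  refine ⟨Fintype.card ι, fun i => A (e i), fun i => B (e i), fun i => D (e i),
    fun i => b (e i), ?_⟩
  ext w
  exact e.forall_congr_right.symm

lemma exists_eq_single_of_sum_eq_one {k : ℕ} {w : Fin k → ℤ} (h0 : ∀ j, 0 ≤ w j)
    (h1 : ∑ j, w j = 1) : ∃ j, w = Pi.single j 1 := by
  classical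
  obtain ⟨j, hj⟩ : ∃ j, w j ≠ 0 := by
    by_contra! h
    simp [h] at h1
  have hj1 : 1 ≤ w j := by have := h0 j; omega
  have hs := Finset.add_sum_erase Finset.univ w (Finset.mem_univ j)
  have hnn : ∀ i ∈ Finset.univ.erase j, 0 ≤ w i := fun i _ => h0 i
  have hz : ∑ i ∈ Finset.univ.erase j, w i = 0 := by
    have := Finset.sum_nonneg hnn
    omega
  have hz' := (Finset.sum_eq_zero_iff_of_nonneg hnn).1 hz
  refine ⟨j, funext fun i => ?_⟩
  by_cases hij : i = j
  · subst hij
    simp only [Pi.single_eq_same]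
    omega
  · simp [hij, hz' i (by simp [hij])]

/-- The point `(m, e_j)` of `ℝ^(k+1)`. -/
def rayPoint {k : ℕ} (j : Fin k) (m : ℝ) : Fin (k + 1) → ℝ :=
  Fin.cons m (Pi.single j 1)

@[simp] lemma rayPoint_zero {k : ℕ} (j : Fin k) (m : ℝ) : rayPoint j m 0 = m := rfl

@[simp] lemma rayPoint_succ {k : ℕ} (j : Fin k) (m : ℝ) (i : Fin k) :
    rayPoint j m i.succ = (Pi.single j 1 : Fin k → ℝ) i := rfl

lemma sum_mul_rayPoint {k : ℕ} (j : Fin k) (m : ℝ) (f : Fin k → ℝ) :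
    ∑ i : Fin k, f i * rayPoint j m i.succ = f j := by
  simp [Pi.single_apply]

lemma rayPoint_mem_integerPoints {k : ℕ} (j : Fin k) (m : ℕ) :
    rayPoint j m ∈ integerPoints (k + 1) := by
  refine ⟨Fin.cons m (Pi.single j 1), funext fun i => ?_⟩
  refine Fin.cases ?_ (fun i => ?_) i
  · simp
  · by_cases h : i = j
    · subst h; simp
    · simp [h]

lemma exists_eq_rayPoint {k : ℕ} {z : Fin (k + 1) → ℝ} (hz : z ∈ integerPoints (k + 1))
    (h0 : ∀ j, 0 ≤ z j) (h1 : ∑ j : Fin k, z j.succ = 1) :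
    ∃ (j : Fin k) (m : ℕ), z = rayPoint j m := by
  obtain ⟨w, rfl⟩ := hz
  have hw : ∀ j, 0 ≤ w j := fun j => by
    have : (0 : ℝ) ≤ w j := h0 j
    exact_mod_cast this
  have hw1 : ∑ j : Fin k, (w j.succ : ℝ) = 1 := h1
  obtain ⟨j, hj⟩ := exists_eq_single_of_sum_eq_one (w := fun j => w j.succ) (fun j => hw _)
    (by exact_mod_cast hw1)
  obtain ⟨m, hm⟩ := Int.eq_ofNat_of_zero_le (hw 0)
  refine ⟨j, m, funext fun i => ?_⟩
  refine Fin.cases ?_ (fun i => ?_) i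
  · simp [hm]
  · rw [rayPoint_succ]
    have := congrFun hj i
    simp only at this ⊢
    rw [this]
    by_cases h : i = j
    · subst h; simp
    · simp [h]

lemma isRationalMILPRepresentable_base_add_mul {W : Set ℕ} (hW : W.Finite) (P : ℕ) :
    IsRationalMILPRepresentable (ofNatSet {n | ∃ b ∈ W, ∃ m : ℕ, n = b + m * P}) := by
  classical
  have := hW.fintype
  set k := Fintype.card W
  set e := (Fintype.equivFin W).symm
  let w : Fin k → ℚ := fun j => ((e j : ℕ) : ℚ)
  -- The first four rows are the equations `x = P z₀ + ∑ w_j z_{j+1}` and `∑ z_{j+1} = 1`, each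
  -- split into two inequalities; the remaining rows are `0 ≤ z_j`.
  refine ⟨0, k + 1, _, isRationalPolyhedron_of_fintype (ι := Fin 4 ⊕ Fin (k + 1))
    (Sum.elim ![fun _ => 1, fun _ => -1, fun _ => 0, fun _ => 0] 0) 0
    (Sum.elim ![Fin.cons (-P) (-w), Fin.cons P w, Fin.cons 0 1, Fin.cons 0 (-1)]
      fun j => Pi.single j (-1))
    (Sum.elim ![0, 0, 1, -1] 0), ?_⟩
  have hchar : ∀ (x : Fin 1 → ℝ) (y : Fin 0 → ℝ) (z : Fin (k + 1) → ℝ),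
      (∀ i : Fin 4 ⊕ Fin (k + 1),
        ∑ j, ((Sum.elim ![fun _ => 1, fun _ => -1, fun _ => 0, fun _ => 0] 0 :
          Fin 4 ⊕ Fin (k + 1) → Fin 1 → ℚ) i j : ℝ) * x j +
        ∑ j, (((0 : Fin 4 ⊕ Fin (k + 1) → Fin 0 → ℚ) i j : ℚ) : ℝ) * y j +
        ∑ j, ((Sum.elim ![Fin.cons (-P) (-w), Fin.cons P w, Fin.cons 0 1, Fin.cons 0 (-1)]
          (fun j => Pi.single j (-1)) : Fin 4 ⊕ Fin (k + 1) → Fin (k + 1) → ℚ) i j : ℝ) * z j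
        ≤ ((Sum.elim ![0, 0, 1, -1] 0 : Fin 4 ⊕ Fin (k + 1) → ℚ) i : ℝ)) ↔
      x 0 = P * z 0 + ∑ j : Fin k, (w j : ℝ) * z j.succ ∧ ∑ j : Fin k, z j.succ = 1 ∧
        ∀ j, 0 ≤ z j := by
    intro x y z
    have hs : ∀ j, ∑ i, (((Pi.single j (-1) : Fin (k + 1) → ℚ) i : ℚ) : ℝ) * z i = -z j := by
      intro j
      rw [Finset.sum_eq_single j]
      · simp
      · intro i _ hij; simp [hij]
      · simp
    rw [Sum.forall]
    simp only [Sum.elim_inl, Sum.elim_inr, Fin.forall_fin_succ (n := 3), Fin.forall_fin_succ (n := 2),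
      Fin.forall_fin_succ (n := 1), Fin.forall_fin_one, hs]
    simp only [Fin.sum_univ_succ (n := k)]
    simp
    constructor
    · rintro ⟨⟨h1, h2, h3, h4⟩, h5⟩
      exact ⟨by linarith, by linarith, h5⟩
    · rintro ⟨h1, h2, h5⟩
      exact ⟨⟨by linarith, by linarith, by linarith, by linarith⟩, h5⟩
  unfold Induces
  ext x
  simp only [Set.mem_ofPred_eq, hchar]
  constructor
  · rintro ⟨_, ⟨b, hb, m, rfl⟩, rfl⟩
    refine ⟨0, rayPoint (Fintype.equivFin W ⟨b, hb⟩) m, rayPoint_mem_integerPoints _ _, ?_, ?_, ?_⟩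
    · rw [sum_mul_rayPoint _ _ fun i => (w i : ℝ)]
      simp [w, e]; ring
    · simp
    · refine Fin.cases (by simp) fun i => ?_
      by_cases h : i = Fintype.equivFin W ⟨b, hb⟩
      · subst h; simp
      · simp [h]
  · rintro ⟨-, z, hz, hx, h1, h0⟩
    obtain ⟨j, m, rfl⟩ := exists_eq_rayPoint hz h0 h1
    rw [sum_mul_rayPoint _ _ fun i => (w i : ℝ)] at hx
    refine ⟨_, ⟨e j, (e j).2, m, rfl⟩, funext fun i => ?_⟩
    rw [Subsingleton.elim i 0, hx]
    simp [w]; ring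

lemma IsPeriodicUpToFinite.exists_milp {S : Set ℕ} (hS : IsPeriodicUpToFinite S) :
    ∃ A₀ T : Set (Fin 1 → ℝ),
      A₀.Finite ∧ IsRationalMILPRepresentable T ∧ ofNatSet S = A₀ ∪ T := by
  obtain ⟨P, hP, F, T, hF, hT, rfl⟩ := hS
  obtain ⟨W, hW, rfl⟩ := exists_finite_base hP hT
  exact ⟨ofNatSet F, _, hF.image _, isRationalMILPRepresentable_base_add_mul hW P,
    Set.image_union _ _ _⟩

/-! ### Periodic sets are rational-MICP representable -/

section Fibers

variable {d : ℕ} {E : Type*}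

lemma isConvexFamily_fibers [AddCommGroup E] [Module ℝ E] {M : Set ((Fin d → ℝ) × E)} (hM : Convex ℝ M) :
    IsConvexFamily (Prod.fst '' M) fun z => {w | (z, w) ∈ M} where
  convex_index := hM.linear_image (LinearMap.fst ℝ _ _)
  convex_fiber z _ := by
    intro w hw w' hw' a b ha hb hab
    have := hM hw hw' ha hb hab
    simpa [← add_smul, hab] using this
  combo_subset := by
    rintro z - z' - t h0 h1 _ ⟨_, ⟨w, hw, rfl⟩, _, ⟨w', hw', rfl⟩, rfl⟩
    exact hM hw hw' h0 (sub_nonneg.2 h1) (by ring)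

/-- The index set, a projection of `M`, need not be closed: the limit condition concerns only
sequences along which the fibre points converge too. -/
lemma isClosedFamily_fibers [TopologicalSpace E] {M : Set ((Fin d → ℝ) × E)} (hM : IsClosed M) :
    IsClosedFamily (Prod.fst '' M) fun z => {w | (z, w) ∈ M} where
  closed_fiber z _ := hM.preimage (Continuous.prodMk_right z)
  lim_mem u v z x _ hv hz hx := by
    have := hM.mem_of_tendsto (hz.prodMk_nhds hx) (Eventually.of_forall hv)
    exact ⟨⟨_, this, rfl⟩, this⟩

end Fibers

/-- The points `((μ, λ), (x, y))` with `λ` in the standard simplex, `μ ≥ 0`,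
`x = P μ + ∑ f_j λ_j` and `μ ^ 2 ≤ (∑_{j ∈ J} λ_j) y`. -/
def conicSet {k : ℕ} (f : Fin k → ℕ) (J : Finset (Fin k)) (P : ℕ) :
    Set ((Fin (k + 1) → ℝ) × ((Fin 1 → ℝ) × (Fin 1 → ℝ))) :=
  {w | (∀ j, 0 ≤ w.1 j) ∧ ∑ j : Fin k, w.1 j.succ = 1 ∧
    w.2.1 0 = P * w.1 0 + ∑ j : Fin k, (f j : ℝ) * w.1 j.succ ∧
    w.1 0 ^ 2 ≤ (∑ j ∈ J, w.1 j.succ) * w.2.2 0 ∧ 0 ≤ w.2.2 0}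

lemma isClosed_conicSet {k : ℕ} (f : Fin k → ℕ) (J : Finset (Fin k)) (P : ℕ) :
    IsClosed (conicSet f J P) := by
  have h : conicSet f J P = (⋂ j, {w | 0 ≤ w.1 j}) ∩ ({w | ∑ j : Fin k, w.1 j.succ = 1} ∩
      ({w | w.2.1 0 = P * w.1 0 + ∑ j : Fin k, (f j : ℝ) * w.1 j.succ} ∩
      ({w | w.1 0 ^ 2 ≤ (∑ j ∈ J, w.1 j.succ) * w.2.2 0} ∩ {w | 0 ≤ w.2.2 0}))) := by
    ext w
    simp [conicSet]
  rw [h]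
  refine (isClosed_iInter fun j => ?_).inter (IsClosed.inter ?_ (IsClosed.inter ?_
    (IsClosed.inter ?_ ?_)))
  · exact isClosed_le (by fun_prop) (by fun_prop)
  · exact isClosed_eq (by fun_prop) (by fun_prop)
  · exact isClosed_eq (by fun_prop) (by fun_prop)
  · exact isClosed_le (by fun_prop) (by fun_prop)
  · exact isClosed_le (by fun_prop) (by fun_prop)

/-- Multiplying the two hypotheses and using AM-GM bounds the cross term: `2 a₁ a₂ ≤ s₁ y₂ + s₂ y₁`.
-/
lemma sq_add_le_rotated_cone {a₁ a₂ s₁ s₂ y₁ y₂ : ℝ} (hs₁ : 0 ≤ s₁) (hs₂ : 0 ≤ s₂) (hy₁ : 0 ≤ y₁)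
    (hy₂ : 0 ≤ y₂) (h₁ : a₁ ^ 2 ≤ s₁ * y₁) (h₂ : a₂ ^ 2 ≤ s₂ * y₂) :
    (a₁ + a₂) ^ 2 ≤ (s₁ + s₂) * (y₁ + y₂) := by
  have h : (2 * a₁ * a₂) ^ 2 ≤ (s₁ * y₂ + s₂ * y₁) ^ 2 := by
    have := mul_le_mul h₁ h₂ (sq_nonneg _) (mul_nonneg hs₁ hy₁)
    nlinarith [sq_nonneg (s₁ * y₂ - s₂ * y₁)]
  have := abs_le_of_sq_le_sq h (by positivity)
  nlinarith [(le_abs_self _).trans this]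

lemma convex_conicSet {k : ℕ} (f : Fin k → ℕ) (J : Finset (Fin k)) (P : ℕ) :
    Convex ℝ (conicSet f J P) := by
  rintro ⟨z, x, y⟩ ⟨h0, h1, hx, hc, hy⟩ ⟨z', x', y'⟩ ⟨h0', h1', hx', hc', hy'⟩ a b ha hb hab
  simp only at h0 h1 hx hc hy h0' h1' hx' hc' hy'
  refine ⟨fun j => ?_, ?_, ?_, ?_, ?_⟩
  · exact add_nonneg (mul_nonneg ha (h0 j)) (mul_nonneg hb (h0' j))
  · simp only [Prod.smul_mk, Prod.mk_add_mk, Pi.add_apply, Pi.smul_apply, smul_eq_mul,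
      Finset.sum_add_distrib, ← Finset.mul_sum, h1, h1']
    linarith
  · simp only [Prod.smul_mk, Prod.mk_add_mk, Pi.add_apply, Pi.smul_apply, smul_eq_mul, hx, hx',
      mul_add, Finset.sum_add_distrib, Finset.mul_sum, mul_left_comm]
    ring
  · simp only [Prod.smul_mk, Prod.mk_add_mk, Pi.add_apply, Pi.smul_apply, smul_eq_mul,
      Finset.sum_add_distrib, ← Finset.mul_sum]
    refine sq_add_le_rotated_cone (mul_nonneg ha (Finset.sum_nonneg fun j _ => h0 _))
      (mul_nonneg hb (Finset.sum_nonneg fun j _ => h0' _)) (mul_nonneg ha hy) (mul_nonneg hb hy')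
      ?_ ?_
    · nlinarith [mul_le_mul_of_nonneg_left hc (sq_nonneg a)]
    · nlinarith [mul_le_mul_of_nonneg_left hc' (sq_nonneg b)]
  · exact add_nonneg (mul_nonneg ha hy) (mul_nonneg hb hy')

/-- The integer points of the index set of `conicSet`. -/
def rayPoints {k : ℕ} (J : Finset (Fin k)) : Set (Fin (k + 1) → ℝ) :=
  {z | ∃ (j : Fin k) (m : ℕ), (j ∈ J ∨ m = 0) ∧ z = rayPoint j m}

lemma rayPoint_nonneg {k : ℕ} (j : Fin k) (m : ℕ) (i : Fin (k + 1)) :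
    0 ≤ rayPoint j (m : ℝ) i := by
  refine Fin.cases (by simp) (fun i => ?_) i
  by_cases h : i = j
  · subst h; simp
  · simp [h]

lemma sum_rayPoint_of_mem {k : ℕ} {J : Finset (Fin k)} {j : Fin k} (hj : j ∈ J) (m : ℝ) :
    ∑ i ∈ J, rayPoint j m i.succ = 1 := by
  simp [Pi.single_apply, hj]

lemma rayPoint_mem_conicSet {k : ℕ} (f : Fin k → ℕ) {J : Finset (Fin k)} (P : ℕ) {j : Fin k}
    {m : ℕ} (h : j ∈ J ∨ m = 0) :
    (rayPoint j (m : ℝ), ((fun _ => ((f j + m * P : ℕ) : ℝ)), fun _ => (m : ℝ) ^ 2)) ∈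
      conicSet f J P := by
  refine ⟨rayPoint_nonneg j m, by simp, ?_, ?_, by positivity⟩
  · rw [sum_mul_rayPoint _ _ fun i => (f i : ℝ)]
    push_cast [rayPoint_zero]; ring
  · rcases h with h | rfl
    · rw [sum_rayPoint_of_mem h]; simp
    · simp

/-- At `λ = e_j` the cone constraint reads `μ ^ 2 ≤ y` if `j ∈ J`, which a large `y` satisfies, and
`μ ^ 2 ≤ 0` otherwise. So exactly the rays over `J` are infinite. -/
lemma index_conicSet_inter_integerPoints {k : ℕ} (f : Fin k → ℕ) (J : Finset (Fin k)) (P : ℕ) :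
    Prod.fst '' conicSet f J P ∩ integerPoints (k + 1) = rayPoints J := by
  ext z
  constructor
  · rintro ⟨⟨⟨z, x, y⟩, ⟨h0, h1, -, hc, -⟩, rfl⟩, hz⟩
    obtain ⟨j, m, rfl⟩ := exists_eq_rayPoint hz h0 h1
    refine ⟨j, m, ?_, rfl⟩
    by_contra! h
    have : ∑ i ∈ J, rayPoint j (m : ℝ) i.succ = 0 :=
      Finset.sum_eq_zero fun i hi => by
        have : i ≠ j := fun hij => h.1 (hij ▸ hi)
        simp [this]
    simp only [this, zero_mul, rayPoint_zero] at hc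
    have : (m : ℝ) = 0 := by nlinarith [sq_nonneg (m : ℝ)]
    exact h.2 (by exact_mod_cast this)
  · rintro ⟨j, m, h, rfl⟩
    exact ⟨⟨_, rayPoint_mem_conicSet f P h, rfl⟩, rayPoint_mem_integerPoints j m⟩

lemma isMICPRepresentation_conicSet {k : ℕ} (f : Fin k → ℕ) (J : Finset (Fin k)) (P : ℕ) :
    IsMICPRepresentation (ofNatSet {n | ∃ (j : Fin k) (m : ℕ), (j ∈ J ∨ m = 0) ∧ n = f j + m * P})
      (Prod.fst '' conicSet f J P) fun z => {w | (z, w) ∈ conicSet f J P} where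
  convexFamily := isConvexFamily_fibers (convex_conicSet f J P)
  closedFamily := isClosedFamily_fibers (isClosed_conicSet f J P)
  eq_iUnion := by
    rw [index_conicSet_inter_integerPoints]
    ext x
    simp only [Set.mem_iUnion, exists_prop]
    constructor
    · rintro ⟨_, ⟨j, m, h, rfl⟩, rfl⟩
      exact ⟨_, ⟨j, m, h, rfl⟩, _, rayPoint_mem_conicSet f P h, rfl⟩
    · rintro ⟨_, ⟨j, m, h, rfl⟩, ⟨x, y⟩, ⟨-, -, hx, -⟩, rfl⟩
      refine ⟨_, ⟨j, m, h, rfl⟩, funext fun i => ?_⟩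
      simp only [sum_mul_rayPoint _ _ fun i => (f i : ℝ)] at hx
      rw [Subsingleton.elim i 0]
      change ((f j + m * P : ℕ) : ℝ) = x 0
      rw [hx, rayPoint_zero]
      push_cast; ring

/-- The unit vector in the direction of the rays. -/
def rayDirection (k : ℕ) : Fin (k + 1) → ℝ := Fin.cons 1 0

lemma rayPoint_add_smul {k : ℕ} (j : Fin k) (m t : ℝ) :
    rayPoint j m + t • rayDirection k = rayPoint j (m + t) := by
  funext i
  refine Fin.cases ?_ (fun i => ?_) i <;> simp [rayDirection]

/-- The rays `{(m, e_j) : m ∈ ℕ}`, `j ∈ J`. -/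
def fullRays {k : ℕ} (J : Finset (Fin k)) : Set (Fin (k + 1) → ℝ) :=
  {z | ∃ j ∈ J, ∃ m : ℕ, z = rayPoint j m}

/-- The preimage of the hull under translation is convex, so it suffices to move a generator
`rayPoint j m`; its translate lies between `rayPoint j m` and `rayPoint j (m + N)` for any natural
`N > t`. -/
lemma add_smul_mem_convexHull_fullRays {k : ℕ} {J : Finset (Fin k)} {x : Fin (k + 1) → ℝ}
    (hx : x ∈ convexHull ℝ (fullRays J)) {t : ℝ} (ht : 0 ≤ t) :
    x + t • rayDirection k ∈ convexHull ℝ (fullRays J) := by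
  suffices h : convexHull ℝ (fullRays J) ⊆
      (fun x => x + t • rayDirection k) ⁻¹' convexHull ℝ (fullRays J) from h hx
  have hconv : Convex ℝ ((fun x => x + t • rayDirection k) ⁻¹' convexHull ℝ (fullRays J)) :=
    (convex_convexHull ℝ _).translate_preimage_left _
  refine convexHull_min ?_ hconv
  rintro _ ⟨j, hj, m, rfl⟩
  obtain ⟨N, hN⟩ := exists_nat_gt t
  have hN0 : (0 : ℝ) < N := ht.trans_lt hN
  have h1 : rayPoint j (m : ℝ) ∈ convexHull ℝ (fullRays J) :=
    subset_convexHull ℝ _ ⟨j, hj, m, rfl⟩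
  have h2 : rayPoint j ((m : ℝ) + N) ∈ convexHull ℝ (fullRays J) :=
    subset_convexHull ℝ _ ⟨j, hj, m + N, by push_cast; rfl⟩
  have h3 := (convex_convexHull ℝ (fullRays J)) h1 h2
    (a := 1 - t / N) (b := t / N) (sub_nonneg.2 ((div_le_one hN0).2 hN.le)) (by positivity)
    (by ring)
  change rayPoint j (m : ℝ) + t • rayDirection k ∈ convexHull ℝ (fullRays J)
  convert h3 using 1
  rw [← rayPoint_add_smul, smul_add, smul_smul, ← add_assoc, ← add_smul, sub_add_cancel, one_smul,
    div_mul_cancel₀ _ hN0.ne']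

lemma isRationallyUnboundedConvex_fullRays {k : ℕ} {J : Finset (Fin k)} (hJ : J.Nonempty) :
    IsRationallyUnboundedConvex (convexHull ℝ (fullRays J)) where
  convex := convex_convexHull ℝ _
  unbounded h := by
    obtain ⟨j, hj⟩ := hJ
    obtain ⟨R, hR⟩ := isBounded_iff_forall_norm_le.1 h
    obtain ⟨m, hm⟩ := exists_nat_gt R
    have h1 := hR (rayPoint j (m : ℝ)) (subset_convexHull ℝ _ ⟨j, hj, m, rfl⟩)
    have h2 := norm_le_pi_norm (rayPoint j (m : ℝ)) 0
    rw [rayPoint_zero, Real.norm_natCast] at h2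
    linarith
  image L C' hC' := by
    subst hC'
    set φ : (Fin (k + 1) → ℝ) →ₗ[ℝ] (Fin (k + 1) → ℝ) :=
      (L.map (fun q : ℚ => (q : ℝ))).mulVecLin with hφ
    change Bornology.IsBounded (φ '' _) ∨ ∃ r ∈ integerPoints (k + 1), r ≠ 0 ∧
      ∀ x ∈ integerPoints (k + 1) ∩ φ '' _, ∀ t : ℝ, 0 ≤ t → x + t • r ∈ φ '' _
    -- If the direction is killed, each ray collapses to a point and the image is the hull of a
    -- finite set. Otherwise the image of the direction is rational, and a multiple of it is the
    -- required `r`.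
    by_cases h0 : φ (rayDirection k) = 0
    · left
      rw [φ.image_convexHull]
      refine (isBounded_convexHull).2 (Set.Finite.isBounded ?_)
      refine (Set.finite_range fun j : Fin k => φ (rayPoint j 0)).subset ?_
      rintro _ ⟨_, ⟨j, -, m, rfl⟩, rfl⟩
      refine ⟨j, ?_⟩
      have := rayPoint_add_smul j 0 m
      rw [zero_add] at this
      simp only [← this, map_add, map_smul, h0, smul_zero, add_zero]
    · right
      obtain ⟨N, hN, w, hw⟩ := exists_common_denominator fun i => L i 0
      have hNr : (N : ℝ) • φ (rayDirection k) = fun i => (w i : ℝ) := by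
        funext i
        have := congrArg (fun q : ℚ => (q : ℝ)) (hw i)
        push_cast at this
        simp [hφ, Matrix.mulVec, dotProduct, rayDirection, Fin.sum_univ_succ, this]
      refine ⟨(N : ℝ) • φ (rayDirection k), hNr ▸ ⟨w, rfl⟩, ?_, ?_⟩
      · exact smul_ne_zero (by exact_mod_cast hN.ne') h0
      · rintro _ ⟨-, y, hy, rfl⟩ t ht
        refine ⟨y + (t * N) • rayDirection k, add_smul_mem_convexHull_fullRays hy (by positivity),
          ?_⟩
        rw [map_add, map_smul, mul_smul]

lemma isBounded_or_isRationallyUnboundedLattice_rayPoints {k : ℕ} (J : Finset (Fin k)) :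
    Bornology.IsBounded (rayPoints J) ∨ IsRationallyUnboundedLattice (rayPoints J) := by
  rcases J.eq_empty_or_nonempty with rfl | hJ
  · left
    refine ((Set.finite_range fun j : Fin k => rayPoint j 0).subset ?_).isBounded
    rintro _ ⟨j, m, h, rfl⟩
    exact ⟨j, by simp_all⟩
  · right
    have hsub : rayPoints J ⊆ integerPoints (k + 1) := by
      rintro _ ⟨j, m, -, rfl⟩
      exact rayPoint_mem_integerPoints j m
    have hdiff : rayPoints J \ (rayPoints J \ fullRays J) = fullRays J := by
      rw [Set.sdiff_sdiff_right_self]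
      refine Set.inter_eq_right.2 ?_
      rintro _ ⟨j, hj, m, rfl⟩
      exact ⟨j, m, Or.inl hj, rfl⟩
    -- The discarded finite set consists of the isolated points `(0, e_j)`, `j ∉ J`; they are not
    -- starting points of rays in the hull.
    refine ⟨hsub, ?_, rayPoints J \ fullRays J, ?_, Set.sdiff_subset, ?_⟩
    · obtain ⟨j, hj⟩ := hJ
      refine Set.infinite_of_injective_forall_mem (f := fun m : ℕ => rayPoint j (m : ℝ))
        (fun m n h => ?_) fun m => ⟨j, m, Or.inl hj, rfl⟩
      have := congrFun h 0
      simpa using this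
    · refine (Set.finite_range fun j : Fin k => rayPoint j 0).subset ?_
      rintro _ ⟨⟨j, m, h, rfl⟩, hn⟩
      rcases h with h | rfl
      · exact absurd ⟨j, h, m, rfl⟩ hn
      · exact ⟨j, by simp⟩
    · rw [hdiff]
      exact isRationallyUnboundedConvex_fullRays hJ

lemma IsPeriodicUpToFinite.exists_fin {S : Set ℕ} (hS : IsPeriodicUpToFinite S) :
    ∃ (k : ℕ) (f : Fin k → ℕ) (J : Finset (Fin k)) (P : ℕ),
      S = {n | ∃ (j : Fin k) (m : ℕ), (j ∈ J ∨ m = 0) ∧ n = f j + m * P} := by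
  classical
  obtain ⟨P, hP, F, T, hF, hT, rfl⟩ := hS
  obtain ⟨W, hW, rfl⟩ := exists_finite_base hP hT
  have := hF.fintype
  have := hW.fintype
  set e := (Fintype.equivFin (F ⊕ W)).symm
  refine ⟨Fintype.card (F ⊕ W), fun j => Sum.elim Subtype.val Subtype.val (e j),
    Finset.univ.filter fun j => (e j).isRight, P, ?_⟩
  ext n
  simp only [Set.mem_union, Set.mem_ofPred_eq, Finset.mem_filter, Finset.mem_univ, true_and]
  rw [e.exists_congr_left, Sum.exists]
  simp

lemma IsPeriodicUpToFinite.isRationalMICPRepresentable {S : Set ℕ}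
    (hS : IsPeriodicUpToFinite S) : IsRationalMICPRepresentable (ofNatSet S) := by
  obtain ⟨k, f, J, P, rfl⟩ := hS.exists_fin
  refine ⟨1, k + 1, _, _, isMICPRepresentation_conicSet f J P, ?_, ?_⟩
  · rintro _ ⟨⟨z, w⟩, hw, rfl⟩
    exact ⟨w, hw⟩
  · rw [index_conicSet_inter_integerPoints]
    exact isBounded_or_isRationallyUnboundedLattice_rayPoints J

/-! ### Midpoint-affine functions along a direction -/

section Slopes

variable {G : Type*} [AddCommGroup G] {Z : Set G} {f : G → ℕ} {r : G}

/-- `f` is affine at those midpoints of pairs of points of `Z` that exist in `G`. -/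
def IsMidpointAffineOn (f : G → ℕ) (Z : Set G) : Prop :=
  ∀ x ∈ Z, ∀ y ∈ Z, ∀ w, x + y = w + w → f x + f y = 2 * f w

lemma add_nsmul_mem_of_add_mem (hr : ∀ x ∈ Z, x + r ∈ Z) {x : G} (hx : x ∈ Z) (m : ℕ) :
    x + m • r ∈ Z := by
  induction m with
  | zero => simpa using hx
  | succ m ih => rw [succ_nsmul, ← add_assoc]; exact hr _ ih

/-- The midpoint relation is a second-order recurrence along `x + m • r`, so two consecutive values
are carried through the induction. -/
lemma IsMidpointAffineOn.apply_add_nsmul (hf : IsMidpointAffineOn f Z) (hr : ∀ x ∈ Z, x + r ∈ Z)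
    {x : G} (hx : x ∈ Z) (m : ℕ) :
    (f (x + m • r) : ℤ) = f x + m * ((f (x + r) : ℤ) - f x) ∧
      (f (x + (m + 1) • r) : ℤ) = f x + (m + 1) * ((f (x + r) : ℤ) - f x) := by
  induction m with
  | zero => simp
  | succ m ih =>
    refine ⟨by push_cast; exact ih.2, ?_⟩
    have h := hf _ (add_nsmul_mem_of_add_mem hr hx m) _ (add_nsmul_mem_of_add_mem hr hx (m + 1 + 1))
      (x + (m + 1) • r) (by simp only [succ_nsmul]; abel)
    have h' : (f (x + m • r) : ℤ) + f (x + (m + 1 + 1) • r) = 2 * f (x + (m + 1) • r) := by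
      exact_mod_cast h
    push_cast
    linarith [ih.1, ih.2]

/-- A slope of at most `-1` would make `f` negative after `f x + 1` steps. -/
lemma IsMidpointAffineOn.le_apply_add (hf : IsMidpointAffineOn f Z) (hr : ∀ x ∈ Z, x + r ∈ Z)
    {x : G} (hx : x ∈ Z) : f x ≤ f (x + r) := by
  by_contra! h
  have h1 := (hf.apply_add_nsmul hr hx (f x + 1)).1
  have h2 : (f (x + r) : ℤ) - f x ≤ -1 := by omega
  have h3 : (0 : ℤ) ≤ f (x + (f x + 1) • r) := Int.natCast_nonneg _
  push_cast at h1
  nlinarith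

/-- The slope along the direction `r` depends only on the class modulo `2`. -/
lemma IsMidpointAffineOn.slope_eq (hf : IsMidpointAffineOn f Z) (hr : ∀ x ∈ Z, x + r ∈ Z)
    {x y v : G} (hx : x ∈ Z) (hy : y ∈ Z) (hxy : x = y + (v + v)) :
    f (x + r) + f y = f (y + r) + f x := by
  have h1 := hf _ hx _ (hr _ (hr _ hx)) (x + r) (by abel)
  have h2 := hf _ hy _ (hr _ (hr _ hy)) (y + r) (by abel)
  -- The pairs `(x, y + 2r)` and `(x + 2r, y)` share the midpoint `y + v + r`, which links the two
  -- slopes.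
  have h3 := hf _ hx _ (hr _ (hr _ hy)) (y + v + r) (by rw [hxy]; abel)
  have h4 := hf _ (hr _ (hr _ hx)) _ hy (y + v + r) (by rw [hxy]; abel)
  omega

/-- Advancing the point with the smaller multiple of `r` leaves its slope unchanged and makes the
two points differ by an even vector, the case of `slope_eq`. -/
lemma IsMidpointAffineOn.slope_eq_of_zsmul (hf : IsMidpointAffineOn f Z)
    (hr : ∀ x ∈ Z, x + r ∈ Z) {c u u' : G} {m m' : ℤ} (hx : c + (u + u) + m • r ∈ Z)
    (hy : c + (u' + u') + m' • r ∈ Z) :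
    f (c + (u + u) + m • r + r) + f (c + (u' + u') + m' • r) =
      f (c + (u' + u') + m' • r + r) + f (c + (u + u) + m • r) := by
  wlog h : m ≤ m' generalizing u u' m m'
  · exact (this hy hx (le_of_not_ge h)).symm
  obtain ⟨k, rfl⟩ := Int.le.dest h
  have h1 := hf.slope_eq hr (add_nsmul_mem_of_add_mem hr hx k) hy (v := u - u')
    (by rw [add_smul, natCast_zsmul]; abel)
  have h2 := hf.apply_add_nsmul hr hx k
  rw [add_assoc, ← succ_nsmul] at h1
  have h2' := h2.1
  have h2'' := h2.2
  have h1' : (f (c + (u + u) + m • r + (k + 1) • r) : ℤ) + f (c + (u' + u') + (m + k) • r) =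
    f (c + (u' + u') + (m + k) • r + r) + f (c + (u + u) + m • r + k • r) := by exact_mod_cast h1
  zify
  linarith

end Slopes

/-! ### Convex sets whose rational images have integer directions -/

/-- The inclusion of `ℤ^d` into `ℝ^d`. -/
def intVec (d : ℕ) : (Fin d → ℤ) →+ (Fin d → ℝ) := (Int.castAddHom ℝ).compLeft (Fin d)

@[simp] lemma intVec_apply {d : ℕ} (w : Fin d → ℤ) (i : Fin d) : intVec d w i = w i := rfl

lemma intVec_injective (d : ℕ) : Function.Injective (intVec d) := fun a b h => by
  funext i
  have := congrFun h i
  simpa using this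

/-- The linear map on `ℝ^d` given by a rational matrix. -/
def ratMap {d : ℕ} (L : Matrix (Fin d) (Fin d) ℚ) : (Fin d → ℝ) →ₗ[ℝ] (Fin d → ℝ) :=
  (L.map fun q : ℚ => (q : ℝ)).mulVecLin

lemma ratMap_mul {d : ℕ} (L M : Matrix (Fin d) (Fin d) ℚ) :
    ratMap (L * M) = ratMap L ∘ₗ ratMap M := by
  have : (L * M).map (fun q : ℚ => (q : ℝ)) =
      L.map (fun q : ℚ => (q : ℝ)) * M.map (fun q : ℚ => (q : ℝ)) :=
    Matrix.map_mul (f := Rat.castHom ℝ)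
  rw [ratMap, this, Matrix.mulVecLin_mul]
  rfl

lemma ratMap_one {d : ℕ} : ratMap (1 : Matrix (Fin d) (Fin d) ℚ) = LinearMap.id := by
  have : (1 : Matrix (Fin d) (Fin d) ℚ).map (fun q : ℚ => (q : ℝ)) = 1 :=
    Matrix.map_one _ Rat.cast_zero Rat.cast_one
  rw [ratMap, this, Matrix.mulVecLin_one]

/-- Every rational linear image of `K` is bounded or has an integer direction of recession. -/
def HasIntegerDirections {d : ℕ} (K : Set (Fin d → ℝ)) : Prop :=
  ∀ L : Matrix (Fin d) (Fin d) ℚ, Bornology.IsBounded (ratMap L '' K) ∨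
    ∃ r : Fin d → ℤ, r ≠ 0 ∧ ∀ x ∈ ratMap L '' K, ∀ t : ℝ, 0 ≤ t →
      x + t • intVec d r ∈ ratMap L '' K

/-- The image under `M` of the halved set is `(M L K - M b) / 2`, so the hypothesis is applied to `M
* L`; translation and scaling affect neither boundedness nor recession directions. -/
lemma HasIntegerDirections.halve {d : ℕ} {K : Set (Fin d → ℝ)} (hK : HasIntegerDirections K)
    (L : Matrix (Fin d) (Fin d) ℚ) (b : Fin d → ℝ) :
    HasIntegerDirections {u | (2 : ℝ) • u + b ∈ ratMap L '' K} := by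
  intro M
  rcases hK (M * L) with h | ⟨r, hr, h⟩
  · left
    obtain ⟨R, hR⟩ := isBounded_iff_forall_norm_le.1 h
    refine isBounded_iff_forall_norm_le.2 ⟨(R + ‖ratMap M b‖) / 2, ?_⟩
    rintro _ ⟨u, ⟨k, hk, hku⟩, rfl⟩
    have h1 := hR _ ⟨k, hk, rfl⟩
    rw [ratMap_mul, LinearMap.comp_apply, hku, map_add, map_smul] at h1
    have h2 := norm_sub_le ((2 : ℝ) • ratMap M u + ratMap M b) (ratMap M b)
    rw [add_sub_cancel_right, norm_smul, Real.norm_two] at h2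
    linarith
  · refine Or.inr ⟨r, hr, ?_⟩
    rintro _ ⟨u, ⟨k, hk, hku⟩, rfl⟩ t ht
    obtain ⟨k', hk', hkk'⟩ := h _ ⟨k, hk, rfl⟩ (2 * t) (by positivity)
    simp only [ratMap_mul, LinearMap.comp_apply, hku] at hkk'
    refine ⟨(1 / 2 : ℝ) • (ratMap L k' - b), ⟨k', hk', ?_⟩, ?_⟩
    · rw [smul_smul]; norm_num
    · rw [map_smul, map_sub, hkk', map_add, map_smul]
      funext i
      simp only [Pi.smul_apply, Pi.sub_apply, Pi.add_apply, smul_eq_mul]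
      ring

lemma convex_halve {d : ℕ} {K : Set (Fin d → ℝ)} (hK : Convex ℝ K)
    (φ : (Fin d → ℝ) →ₗ[ℝ] (Fin d → ℝ)) (b : Fin d → ℝ) :
    Convex ℝ {u | (2 : ℝ) • u + b ∈ φ '' K} :=
  (hK.linear_image φ).affine_preimage
    ((2 : ℝ) • (LinearMap.id : (Fin d → ℝ) →ₗ[ℝ] (Fin d → ℝ)).toAffineMap +
      AffineMap.const ℝ (Fin d → ℝ) b)

/-- Differences in the halved set lie in the image under `φ` of the span of `K`, and `φ` kills the
nonzero vector `v` of that span. -/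
lemma finrank_vectorSpan_halve_lt {d : ℕ} {K : Set (Fin d → ℝ)}
    (φ : (Fin d → ℝ) →ₗ[ℝ] (Fin d → ℝ)) (b : Fin d → ℝ) {v : Fin d → ℝ}
    (hv : v ∈ vectorSpan ℝ K) (hv0 : v ≠ 0) (hφ : φ v = 0) :
    Module.finrank ℝ (vectorSpan ℝ {u | (2 : ℝ) • u + b ∈ φ '' K}) <
      Module.finrank ℝ (vectorSpan ℝ K) := by
  have hle : vectorSpan ℝ {u | (2 : ℝ) • u + b ∈ φ '' K} ≤ (vectorSpan ℝ K).map φ := by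
    rw [vectorSpan_def, Submodule.span_le]
    rintro _ ⟨u, ⟨k, hk, hku⟩, u', ⟨k', hk', hku'⟩, rfl⟩
    refine ⟨(1 / 2 : ℝ) • (k - k'), Submodule.smul_mem _ _ (vsub_mem_vectorSpan ℝ hk hk'), ?_⟩
    rw [map_smul, map_sub, hku, hku']
    funext i
    simp only [Pi.smul_apply, Pi.sub_apply, Pi.add_apply, smul_eq_mul, vsub_eq_sub]
    ring
  refine (Submodule.finrank_mono hle).trans_lt ?_
  have h1 := LinearMap.finrank_range_add_finrank_ker (φ.domRestrict (vectorSpan ℝ K))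
  rw [LinearMap.range_domRestrict] at h1
  have : Nontrivial (LinearMap.ker (φ.domRestrict (vectorSpan ℝ K))) :=
    ⟨⟨⟨v, hv⟩, hφ⟩, 0, fun h => hv0 (by simpa using congrArg (fun x => (x.1.1 : Fin d → ℝ)) h)⟩
  have h2 := Module.finrank_pos (R := ℝ) (M := LinearMap.ker (φ.domRestrict (vectorSpan ℝ K)))
  omega

lemma finite_intVec_mem_of_isBounded {d : ℕ} {K : Set (Fin d → ℝ)} (hK : Bornology.IsBounded K) :
    {x | intVec d x ∈ K}.Finite := by
  obtain ⟨R, hR⟩ := isBounded_iff_forall_norm_le.1 hK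
  obtain ⟨N, hN⟩ := exists_nat_ge R
  refine (Set.finite_Icc (fun _ : Fin d => -(N : ℤ)) fun _ => (N : ℤ)).subset fun x hx => ?_
  have h : ∀ i, |(x i : ℝ)| ≤ N := fun i =>
    ((norm_le_pi_norm (intVec d x) i).trans (hR _ hx)).trans hN
  have h' : ∀ i, |x i| ≤ N := fun i => by exact_mod_cast h i
  exact ⟨fun i => (abs_le.1 (h' i)).1, fun i => (abs_le.1 (h' i)).2⟩

/-- The projection along `r` onto the hyperplane `x i = 0`. -/
def projMatrix {d : ℕ} (r : Fin d → ℤ) (i : Fin d) : Matrix (Fin d) (Fin d) ℚ :=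
  1 - Matrix.vecMulVec (fun j => (r j : ℚ)) (Pi.single i ((r i : ℚ)⁻¹))

lemma ratMap_projMatrix {d : ℕ} (r : Fin d → ℤ) (i : Fin d) (x : Fin d → ℝ) :
    ratMap (projMatrix r i) x = x - (x i / r i) • intVec d r := by
  funext j
  have h : ∀ k, (((Pi.single i ((r i : ℚ)⁻¹) : Fin d → ℚ) k : ℚ) : ℝ) =
      if k = i then (r i : ℝ)⁻¹ else 0 := fun k => by
    by_cases hk : k = i
    · subst hk; simp
    · simp [hk]
  simp only [ratMap, projMatrix, Matrix.mulVecLin_apply, Matrix.mulVec, dotProduct,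
    Matrix.map_apply, Matrix.sub_apply, Matrix.vecMulVec_apply, Rat.cast_sub, Rat.cast_mul, h,
    sub_mul, Finset.sum_sub_distrib, Pi.sub_apply, Pi.smul_apply, smul_eq_mul, intVec_apply,
    Rat.cast_intCast]
  congr 1
  · rw [Finset.sum_eq_single j]
    · simp
    · intro k _ hk; simp [hk.symm]
    · simp
  · rw [Finset.sum_eq_single i]
    · simp; ring
    · intro k _ hk; simp [hk]
    · simp

/-! ### Values of midpoint-affine functions -/

section Classes

variable {d : ℕ}

/-- The points of `Z` in the class of `c` modulo `r` and twice the lattice `u i = 0`. -/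
def latticeClass (Z : Set (Fin d → ℤ)) (r : Fin d → ℤ) (i : Fin d) (c : Fin d → ℤ) :
    Set (Fin d → ℤ) :=
  {x ∈ Z | ∃ (u : Fin d → ℤ) (m : ℤ), u i = 0 ∧ x = c + (u + u) + m • r}

lemma exists_finite_classes (Z : Set (Fin d → ℤ)) {r : Fin d → ℤ} {i : Fin d} (hi : r i ≠ 0) :
    ∃ s : Set (Fin d → ℤ), s.Finite ∧ Z = ⋃ c ∈ s, latticeClass Z r i c := by
  -- A multiple of `r` brings coordinate `i` into `[0, |r i|)`; the other coordinates are then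
  -- reduced modulo 2. Coordinate `i` is not halved because `u` must lie in the hyperplane onto
  -- which `projMatrix r i` projects.
  refine ⟨Set.Icc 0 fun _ => 2 + |r i|, Set.finite_Icc _ _, ?_⟩
  ext x
  simp only [Set.mem_iUnion, exists_prop]
  refine ⟨fun hx => ?_, fun ⟨c, _, hx⟩ => hx.1⟩
  let y : Fin d → ℤ := x - (x i / r i) • r
  have hyi : y i = x i % r i := by
    simp only [y, Pi.sub_apply, Pi.smul_apply, smul_eq_mul]
    linarith [Int.mul_ediv_add_emod (x i) (r i)]
  refine ⟨fun j => if j = i then y j else y j % 2, ⟨fun j => ?_, fun j => ?_⟩, hx,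
    fun j => if j = i then 0 else y j / 2, x i / r i, by simp, ?_⟩
  · by_cases h : j = i
    · subst h
      simp only [if_true, Pi.zero_apply, hyi]
      exact Int.emod_nonneg _ hi
    · simp only [if_neg h, Pi.zero_apply]
      exact Int.emod_nonneg _ two_ne_zero
  · by_cases h : j = i
    · subst h
      simp only [if_true, hyi]
      linarith [Int.emod_lt_abs (x j) hi]
    · simp only [if_neg h]
      linarith [Int.emod_lt_of_pos (y j) two_pos, abs_nonneg (r i)]
  · funext j
    have hxy : x j = y j + (x i / r i) * r j := by simp [y]
    rw [hxy]
    by_cases h : j = i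
    · simp [h]
    · simp [h]; omega

lemma IsMidpointAffineOn.isPeriodicUpToFinite_class {Z : Set (Fin d → ℤ)} {f : (Fin d → ℤ) → ℕ}
    {r : Fin d → ℤ} (hf : IsMidpointAffineOn f Z) (hr : ∀ x ∈ Z, x + r ∈ Z) {i : Fin d}
    {c : Fin d → ℤ} {x : Fin d → ℤ} (hx : x ∈ latticeClass Z r i c) (hne : f (x + r) ≠ f x) :
    IsPeriodicUpToFinite (f '' latticeClass Z r i c) := by
  have hle := hf.le_apply_add hr hx.1
  refine IsPeriodicUpToFinite.of_add_mem (P := f (x + r) - f x) (by omega) ?_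
  rintro _ ⟨y, ⟨hyZ, u', m', hu', rfl⟩, rfl⟩
  obtain ⟨hxZ, u, m, hu, rfl⟩ := hx
  refine ⟨c + (u' + u') + m' • r + r, ⟨hr _ hyZ, u', m' + 1, hu', ?_⟩, ?_⟩
  · rw [add_smul, one_smul]
    abel
  · have := hf.slope_eq_of_zsmul hr hxZ hyZ
    omega

end Classes

lemma zsmul_intVec_add_mem {d : ℕ} {K : Set (Fin d → ℝ)} {r : Fin d → ℤ}
    (hr : ∀ x ∈ K, ∀ t : ℝ, 0 ≤ t → x + t • intVec d r ∈ K) {x : Fin d → ℤ} {t : ℝ}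
    (hx : intVec d x + t • intVec d r ∈ K) {m : ℤ} (hm : t ≤ m) : intVec d (x + m • r) ∈ K := by
  have h := hr _ hx (m - t) (sub_nonneg.2 hm)
  rw [add_assoc, ← add_smul, add_sub_cancel, Int.cast_smul_eq_zsmul] at h
  rwa [map_add, map_zsmul]

/-- The inductive step in a direction of slope zero: `f` descends to the projection. -/
lemma exists_descent {d : ℕ} {K : Set (Fin d → ℝ)} (hKc : Convex ℝ K) {f : (Fin d → ℤ) → ℕ}
    (hf : IsMidpointAffineOn f {x | intVec d x ∈ K}) {r : Fin d → ℤ}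
    (hr : ∀ x ∈ K, ∀ t : ℝ, 0 ≤ t → x + t • intVec d r ∈ K) {i : Fin d} (hi : r i ≠ 0)
    {c : Fin d → ℤ}
    (h0 : ∀ x ∈ latticeClass {x | intVec d x ∈ K} r i c, f (x + r) = f x) :
    ∃ g : (Fin d → ℤ) → ℕ,
      IsMidpointAffineOn g {u | intVec d u ∈ {u | (2 : ℝ) • u + ratMap (projMatrix r i) (intVec d c) ∈
        ratMap (projMatrix r i) '' K}} ∧
      f '' latticeClass {x | intVec d x ∈ K} r i c =
        g '' {u | intVec d u ∈ {u | (2 : ℝ) • u + ratMap (projMatrix r i) (intVec d c) ∈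
        ratMap (projMatrix r i) '' K}} := by
  classical
  set φ := ratMap (projMatrix r i) with hφ
  have hi' : (r i : ℝ) ≠ 0 := by exact_mod_cast hi
  have hrZ : ∀ x ∈ {x | intVec d x ∈ K}, x + r ∈ {x | intVec d x ∈ K} := fun x hx => by
    have := hr _ hx 1 zero_le_one
    rw [one_smul, ← map_add] at this
    exact this
  -- A lattice point of the halved projection lifts to a possibly non-integral point of `K` on the
  -- line in direction `r`; since `r` is a recession direction, all lattice points far enough along
  -- that line are in `K`.
  have hlift : ∀ u : Fin d → ℤ, intVec d u ∈ {u | (2 : ℝ) • u + φ (intVec d c) ∈ φ '' K} →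
      u i = 0 ∧ ∃ t : ℝ, ∀ m : ℤ, t ≤ m → intVec d (c + (u + u) + m • r) ∈ K := by
    rintro u ⟨k, hk, hku⟩
    rw [hφ, ratMap_projMatrix, ratMap_projMatrix] at hku
    have hui : (u i : ℝ) = 0 := by
      have := congrFun hku i
      simp only [Pi.sub_apply, Pi.add_apply, Pi.smul_apply, smul_eq_mul, intVec_apply,
        div_mul_cancel₀ _ hi'] at this
      linarith
    refine ⟨by exact_mod_cast hui, k i / r i - intVec d c i / r i, fun m hm => ?_⟩
    refine zsmul_intVec_add_mem hr ?_ hm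
    convert hk using 1
    rw [map_add, map_add, ← two_smul ℝ (intVec d u), sub_smul]
    linear_combination (exp := 1) -hku
  have hmem : ∀ (u : Fin d → ℤ) (m : ℤ), u i = 0 → intVec d (c + (u + u) + m • r) ∈ K →
      intVec d u ∈ {u | (2 : ℝ) • u + φ (intVec d c) ∈ φ '' K} := by
    intro u m hu hK
    refine ⟨_, hK, ?_⟩
    have h1 : φ (intVec d u) = intVec d u := by
      rw [hφ, ratMap_projMatrix]; simp [hu]
    have h2 : φ (intVec d r) = 0 := by
      rw [hφ, ratMap_projMatrix, intVec_apply, div_self hi', one_smul, sub_self]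
    simp only [map_add, map_zsmul, h1, h2, smul_zero, add_zero, two_smul]
    abel
  have hconst : ∀ (u : Fin d → ℤ) (m m' : ℤ), u i = 0 → intVec d (c + (u + u) + m • r) ∈ K →
      intVec d (c + (u + u) + m' • r) ∈ K →
      f (c + (u + u) + m • r) = f (c + (u + u) + m' • r) := by
    intro u m m' hu hm hm'
    wlog h : m ≤ m' generalizing m m'
    · exact (this m' m hm' hm (le_of_not_ge h)).symm
    obtain ⟨k, rfl⟩ := Int.le.dest h
    have h1 := (hf.apply_add_nsmul hrZ hm k).1
    rw [h0 _ ⟨hm, u, m, hu, rfl⟩, sub_self, mul_zero, add_zero] at h1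
    rw [add_smul, natCast_zsmul, ← add_assoc (c + (u + u))]
    exact_mod_cast h1.symm
  -- The value of `f` at any lift, independent of the lift by `hconst`; the default 0 is never used
  -- on the relevant set.
  let g : (Fin d → ℤ) → ℕ := fun u =>
    if h : ∃ m : ℤ, intVec d (c + (u + u) + m • r) ∈ K then f (c + (u + u) + h.choose • r) else 0
  have hg : ∀ (u : Fin d → ℤ) (m : ℤ), u i = 0 → intVec d (c + (u + u) + m • r) ∈ K →
      g u = f (c + (u + u) + m • r) := by
    intro u m hu hm
    have h : ∃ m : ℤ, intVec d (c + (u + u) + m • r) ∈ K := ⟨m, hm⟩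
    simp only [g, dif_pos h]
    exact hconst u _ _ hu h.choose_spec hm
  refine ⟨g, ?_, ?_⟩
  · intro u hu u' hu' w hw
    obtain ⟨hui, t, ht⟩ := hlift u hu
    obtain ⟨hui', t', ht'⟩ := hlift u' hu'
    -- Lifting both points with the same `m` makes the midpoint of the lifts a lift of `w`.
    obtain ⟨m, hm⟩ := exists_int_ge (max t t')
    have hx := ht m ((le_max_left _ _).trans hm)
    have hy := ht' m ((le_max_right _ _).trans hm)
    have hwi : w i = 0 := by
      have := congrFun hw i
      simp only [Pi.add_apply, hui, hui'] at this
      omega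
    have hsum : (c + (u + u) + m • r) + (c + (u' + u') + m • r) =
        (c + (w + w) + m • r) + (c + (w + w) + m • r) := by
      rw [← hw]; abel
    have hz : intVec d (c + (w + w) + m • r) ∈ K := by
      have h := hKc hx hy (a := 1 / 2) (b := 1 / 2) (by norm_num) (by norm_num) (by norm_num)
      rwa [← smul_add, ← map_add, hsum, map_add, ← two_smul ℝ, smul_smul, one_div,
        inv_mul_cancel₀ two_ne_zero, one_smul] at h
    rw [hg u m hui hx, hg u' m hui' hy, hg w m hwi hz]
    exact hf _ hx _ hy _ hsum
  · ext n
    constructor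
    · rintro ⟨_, ⟨hxK, u, m, hu, rfl⟩, rfl⟩
      exact ⟨u, hmem u m hu hxK, hg u m hu hxK⟩
    · rintro ⟨u, hu, rfl⟩
      obtain ⟨hui, t, ht⟩ := hlift u hu
      obtain ⟨m, hm⟩ := exists_int_ge t
      exact ⟨_, ⟨ht m hm, u, m, hui, rfl⟩, (hg u m hui (ht m hm)).symm⟩

/-- The values of a midpoint-affine function on the integer points of a convex set with integer
directions form a periodic set, up to finitely many values. -/
theorem IsMidpointAffineOn.isPeriodicUpToFinite_image {d : ℕ} {K : Set (Fin d → ℝ)}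
    (hKc : Convex ℝ K) (hK : HasIntegerDirections K) {f : (Fin d → ℤ) → ℕ}
    (hf : IsMidpointAffineOn f {x | intVec d x ∈ K}) :
    IsPeriodicUpToFinite (f '' {x | intVec d x ∈ K}) := by
  induction hn : Module.finrank ℝ (vectorSpan ℝ K) using Nat.strong_induction_on
    generalizing K f with
  | _ n ih =>
  rcases K.eq_empty_or_nonempty with rfl | ⟨k, hk⟩
  · exact IsPeriodicUpToFinite.of_finite (by simp)
  have h1 := hK 1
  simp only [ratMap_one, LinearMap.id_coe, Set.image_id] at h1
  rcases h1 with hb | ⟨r, hr0, hr⟩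
  · exact IsPeriodicUpToFinite.of_finite ((finite_intVec_mem_of_isBounded hb).image f)
  have hrZ : ∀ x ∈ {x | intVec d x ∈ K}, x + r ∈ {x | intVec d x ∈ K} := fun x hx => by
    have := hr _ hx 1 zero_le_one
    rw [one_smul, ← map_add] at this
    exact this
  obtain ⟨i, hi⟩ : ∃ i, r i ≠ 0 := by
    by_contra! h
    exact hr0 (funext h)
  obtain ⟨s, hs, hZ⟩ := exists_finite_classes {x | intVec d x ∈ K} hi
  rw [hZ, Set.image_iUnion₂]
  refine IsPeriodicUpToFinite.biUnion hs fun c _ => ?_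
  by_cases h0 : ∀ x ∈ latticeClass {x | intVec d x ∈ K} r i c, f (x + r) = f x
  · obtain ⟨g, hg, hfg⟩ := exists_descent hKc hf hr hi h0
    rw [hfg]
    refine ih _ ?_ (convex_halve hKc _ _) (hK.halve _ _) hg rfl
    rw [← hn]
    refine finrank_vectorSpan_halve_lt _ _ (v := intVec d r) ?_ ?_ ?_
    · have := vsub_mem_vectorSpan ℝ (hr k hk 1 zero_le_one) hk
      simpa using this
    · exact (map_ne_zero_iff _ (intVec_injective d)).2 hr0
    · rw [ratMap_projMatrix, intVec_apply, div_self (by exact_mod_cast hi), one_smul, sub_self]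
  · push Not at h0
    obtain ⟨x, hx, hne⟩ := h0
    exact hf.isPeriodicUpToFinite_class hrZ hx hne

/-! ### Rational-MICP representable sets of natural numbers -/

/-- The definition provides rays only from integer points. Multiplying `L` by a common denominator
makes the images of the generators `A` integral, and convexity extends the rays from them to the
whole image. -/
lemma IsRationallyUnboundedConvex.hasIntegerDirections {d : ℕ} {A : Set (Fin d → ℝ)}
    (hA : A ⊆ integerPoints d) (h : IsRationallyUnboundedConvex (convexHull ℝ A)) :
    HasIntegerDirections (convexHull ℝ A) := by
  intro L
  obtain ⟨N, hN, w, hw⟩ := exists_common_denominator fun q : Fin d × Fin d => L q.1 q.2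
  have hN0 : (N : ℝ) ≠ 0 := by exact_mod_cast hN.ne'
  have hscale : ∀ x, ratMap ((N : ℚ) • L) x = (N : ℝ) • ratMap L x := by
    intro x
    funext j
    simp [ratMap, Matrix.mulVec, dotProduct, Finset.mul_sum, mul_assoc]
  have hint : ∀ x ∈ A, ratMap ((N : ℚ) • L) x ∈ integerPoints d := by
    intro x hx
    obtain ⟨z, rfl⟩ := hA hx
    refine ⟨fun j => ∑ k, w (j, k) * z k, funext fun j => ?_⟩
    have : ∀ k, (w (j, k) : ℝ) = N * L j k := fun k => by
      have := congrArg (fun q : ℚ => (q : ℝ)) (hw (j, k))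
      push_cast at this
      exact this.symm
    simp [ratMap, Matrix.mulVec, dotProduct, this]
  rcases h.image ((N : ℚ) • L) _ rfl with hb | ⟨_, ⟨r, rfl⟩, hr0, hr⟩
  · left
    change Bornology.IsBounded (ratMap ((N : ℚ) • L) '' _) at hb
    obtain ⟨R, hR⟩ := isBounded_iff_forall_norm_le.1 hb
    refine isBounded_iff_forall_norm_le.2 ⟨R, ?_⟩
    rintro _ ⟨x, hx, rfl⟩
    refine le_trans ?_ (hR _ ⟨x, hx, rfl⟩)
    rw [hscale, norm_smul, Real.norm_natCast]
    exact le_mul_of_one_le_left (norm_nonneg _) (by exact_mod_cast hN)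
  · right
    change intVec d r ≠ 0 at hr0
    change ∀ x ∈ integerPoints d ∩ ratMap ((N : ℚ) • L) '' convexHull ℝ A, ∀ t : ℝ, 0 ≤ t →
      x + t • intVec d r ∈ ratMap ((N : ℚ) • L) '' convexHull ℝ A at hr
    refine ⟨r, fun h => hr0 (by rw [h, map_zero]), ?_⟩
    have hall : ∀ t : ℝ, 0 ≤ t → ∀ x ∈ ratMap ((N : ℚ) • L) '' convexHull ℝ A,
        x + t • intVec d r ∈ ratMap ((N : ℚ) • L) '' convexHull ℝ A := by
      intro t ht x hx
      have hconv : Convex ℝ ((fun x => x + t • intVec d r) ⁻¹'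
          (ratMap ((N : ℚ) • L) '' convexHull ℝ A)) :=
        ((convex_convexHull ℝ A).linear_image _).translate_preimage_left _
      rw [LinearMap.image_convexHull] at hx
      refine convexHull_min ?_ hconv hx
      rintro _ ⟨y, hy, rfl⟩
      exact hr _ ⟨hint y hy, y, subset_convexHull ℝ A hy, rfl⟩ t ht
    rintro _ ⟨x, hx, rfl⟩ t ht
    obtain ⟨y, hy, hxy⟩ := hall (N * t) (by positivity) _ ⟨x, hx, rfl⟩
    refine ⟨y, hy, ?_⟩
    simp only [hscale, mul_smul, ← smul_add] at hxy
    exact smul_right_injective _ hN0 hxy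

/-- A convex subset of `ℕ ⊆ ℝ^1` has at most one point. -/
lemma eq_of_convex_subset_ofNatSet {X : Set (Fin 1 → ℝ)} (hX : Convex ℝ X)
    (hN : ∀ x ∈ X, ∃ n : ℕ, x = fun _ => (n : ℝ)) {a b : ℕ}
    (ha : (fun _ => (a : ℝ)) ∈ X) (hb : (fun _ => (b : ℝ)) ∈ X) : a = b := by
  wlog h : a < b generalizing a b
  · rcases lt_trichotomy a b with h' | h' | h'
    · exact this ha hb h'
    · exact h'
    · exact (this hb ha h').symm
  have hpos : (0 : ℝ) < b - a := sub_pos.2 (by exact_mod_cast h)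
  have hone : (1 : ℝ) ≤ b - a := by
    have : (a : ℝ) + 1 ≤ b := by exact_mod_cast h
    linarith
  -- The weights produce the point `a + 1/2`, which is not an integer.
  obtain ⟨n, hn⟩ := hN _ (hX ha hb (a := 1 - 1 / (2 * (b - a))) (b := 1 / (2 * (b - a)))
    (sub_nonneg.2 ((div_le_one (by positivity)).2 (by linarith))) (by positivity) (by ring))
  have h1 := congrFun hn 0
  simp only [Pi.add_apply, Pi.smul_apply, smul_eq_mul] at h1
  have h2 : (1 - 1 / (2 * ((b : ℝ) - a))) * a + 1 / (2 * (b - a)) * b = a + 1 / 2 := by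
    field_simp
    ring
  rw [h2] at h1
  have h3 : (2 * a + 1 : ℝ) = 2 * n := by linarith
  have h4 : 2 * a + 1 = 2 * n := by exact_mod_cast h3
  omega

lemma IsMICPRepresentation.exists_fun {p d : ℕ} {S : Set ℕ} {C : Set (Fin d → ℝ)}
    {B : (Fin d → ℝ) → Set ((Fin 1 → ℝ) × (Fin p → ℝ))}
    (h : IsMICPRepresentation (ofNatSet S) C B) (hB : ∀ z ∈ C, (B z).Nonempty) :
    ∃ f : (Fin d → ℤ) → ℕ, IsMidpointAffineOn f {x | intVec d x ∈ C} ∧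
      S = f '' {x | intVec d x ∈ C} := by
  classical
  have hproj : ∀ z : Fin d → ℤ, intVec d z ∈ C → ∀ x ∈ Prod.fst '' B (intVec d z),
      ∃ n ∈ S, x = fun _ => (n : ℝ) := by
    intro z hz x hx
    have : x ∈ ofNatSet S := by
      rw [h.eq_iUnion]
      exact Set.mem_biUnion ⟨hz, z, rfl⟩ hx
    obtain ⟨n, hn, rfl⟩ := this
    exact ⟨n, hn, rfl⟩
  have hex : ∀ z : Fin d → ℤ, ∃ n : ℕ, intVec d z ∈ C →
      n ∈ S ∧ (fun _ => (n : ℝ)) ∈ Prod.fst '' B (intVec d z) := by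
    intro z
    by_cases hz : intVec d z ∈ C
    · obtain ⟨w, hw⟩ := hB _ hz
      obtain ⟨n, hn, hwn⟩ := hproj z hz _ ⟨w, hw, rfl⟩
      exact ⟨n, fun _ => ⟨hn, hwn ▸ ⟨w, hw, rfl⟩⟩⟩
    · exact ⟨0, fun h => absurd h hz⟩
  choose f hf using hex
  have huniq : ∀ z : Fin d → ℤ, intVec d z ∈ C → ∀ a b : ℕ,
      (fun _ => (a : ℝ)) ∈ Prod.fst '' B (intVec d z) →
      (fun _ => (b : ℝ)) ∈ Prod.fst '' B (intVec d z) → a = b := fun z hz a b ha hb =>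
    eq_of_convex_subset_ofNatSet
      ((h.convexFamily.convex_fiber _ hz).linear_image (LinearMap.fst ℝ _ _))
      (fun x hx => (hproj z hz x hx).imp fun n hn => hn.2) ha hb
  refine ⟨f, ?_, ?_⟩
  · intro x hx y hy w hw
    obtain ⟨-, v, hv, hvx⟩ := hf x hx
    obtain ⟨-, v', hv', hvy⟩ := hf y hy
    have hmid : (1 / 2 : ℝ) • intVec d x + (1 - 1 / 2 : ℝ) • intVec d y = intVec d w := by
      rw [show (1 - 1 / 2 : ℝ) = 1 / 2 by norm_num, ← smul_add, ← map_add, hw, map_add,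
        ← two_smul ℝ, smul_smul, one_div, inv_mul_cancel₀ two_ne_zero, one_smul]
    have hwC : intVec d w ∈ C := by
      rw [← hmid]
      exact h.convexFamily.convex_index hx hy (by norm_num) (by norm_num) (by norm_num)
    have hvw : (1 / 2 : ℝ) • v + (1 - 1 / 2 : ℝ) • v' ∈ B (intVec d w) := by
      rw [← hmid]
      exact h.convexFamily.combo_subset _ hx _ hy (1 / 2) (by norm_num) (by norm_num)
        (Set.add_mem_add (Set.smul_mem_smul_set hv) (Set.smul_mem_smul_set hv'))
    obtain ⟨n, -, hn⟩ := hproj w hwC _ ⟨_, hvw, rfl⟩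
    have hwn := huniq w hwC _ _ (hf w hwC).2 ⟨_, hvw, hn⟩
    have h1 := congrFun hn 0
    simp only [Prod.fst_add, Prod.smul_fst, hvx, hvy, Pi.add_apply, Pi.smul_apply,
      smul_eq_mul] at h1
    have h2 : (f x + f y : ℝ) = 2 * n := by linarith
    rw [hwn]
    exact_mod_cast h2
  · ext n
    constructor
    · intro hn
      have : (fun _ => (n : ℝ)) ∈ ofNatSet S := ⟨n, hn, rfl⟩
      rw [h.eq_iUnion] at this
      obtain ⟨_, ⟨hz, z, rfl⟩, hx⟩ := Set.mem_iUnion₂.1 this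
      exact ⟨z, hz, huniq z hz _ _ (hf z hz).2 hx⟩
    · rintro ⟨z, hz, rfl⟩
      exact (hf z hz).1

lemma IsRationalMICPRepresentable.isPeriodicUpToFinite {S : Set ℕ}
    (hS : IsRationalMICPRepresentable (ofNatSet S)) : IsPeriodicUpToFinite S := by
  obtain ⟨p, d, C, B, hrep, hB, hC⟩ := hS
  obtain ⟨f, hf, rfl⟩ := hrep.exists_fun hB
  have hmem : ∀ x : Fin d → ℤ, intVec d x ∈ C → intVec d x ∈ C ∩ integerPoints d :=
    fun x hx => ⟨hx, x, rfl⟩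
  rcases hC with hC | hC
  · refine IsPeriodicUpToFinite.of_finite
      (((finite_intVec_mem_of_isBounded hC).subset ?_).image f)
    exact hmem
  · obtain ⟨I, hI, -, hconv⟩ := hC.exists_finite
    set A := (C ∩ integerPoints d) \ I
    have hAZ : A ⊆ integerPoints d := fun x hx => hx.1.2
    have hAC : convexHull ℝ A ⊆ C :=
      convexHull_min (fun x hx => hx.1.1) hrep.convexFamily.convex_index
    -- Passing to the hull adds no lattice points outside `C`, because `C` is convex; only the
    -- finite set `I` is treated separately.
    have hsplit : {x | intVec d x ∈ C} =
        (intVec d ⁻¹' I ∩ {x | intVec d x ∈ C}) ∪ {x | intVec d x ∈ convexHull ℝ A} := by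
      ext x
      constructor
      · intro hx
        by_cases hxI : intVec d x ∈ I
        · exact Or.inl ⟨hxI, hx⟩
        · exact Or.inr (subset_convexHull ℝ A ⟨hmem x hx, hxI⟩)
      · rintro (hx | hx)
        · exact hx.2
        · exact hAC hx
    rw [hsplit, Set.image_union]
    refine (IsPeriodicUpToFinite.of_finite (((hI.preimage
      (intVec_injective d).injOn).inter_of_left _).image f)).union ?_
    exact IsMidpointAffineOn.isPeriodicUpToFinite_image (convex_convexHull ℝ A)
      (hconv.hasIntegerDirections hAZ) fun x hx y hy => hf x (hAC hx) y (hAC hy)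

end MICP

theorem mainTheorem3 (S : Set ℕ) :
    List.TFAE [
      MICP.IsRationalMICPRepresentable (MICP.ofNatSet S),
      ∃ (k : ℕ) (A₀ : Set ℕ) (A : Fin k → Set ℕ),
        A₀.Finite ∧ (∀ i, MICP.IsInfiniteAP (A i)) ∧ S = A₀ ∪ ⋃ i, A i,
      ∃ A₀ T : Set (Fin 1 → ℝ),
        A₀.Finite ∧ MICP.IsRationalMILPRepresentable T ∧ MICP.ofNatSet S = A₀ ∪ T] := by
  tfae_have 1 → 2 := fun h => h.isPeriodicUpToFinite.exists_isInfiniteAP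
  tfae_have 2 → 3 := by
    rintro ⟨k, A₀, A, h₀, hA, rfl⟩
    exact (MICP.IsPeriodicUpToFinite.of_iUnion_isInfiniteAP h₀ hA).exists_milp
  tfae_have 3 → 1 := fun ⟨_, _, h₀, hT, h⟩ =>
    (MICP.isPeriodicUpToFinite_of_milp h₀ hT h).isRationalMICPRepresentable
  tfae_finish
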